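/- Let $n\ge 0$ be an integer and let $\theta=(\theta_{ij})$ be a skew-symmetric complex $n\times n$ matrix. Put $q_{ij}=\exp(\tfrac{\mathrm i}{2}\theta_{ij})$, and let $\mathcal A=\mathcal A(\mathbb{CP}^n_\theta)$ be the quadratic $\mathbb C$-algebra with generators $w_1,\dots,w_{n+1}$ and relations $$w_{n+1}w_i=w_iw_{n+1}\quad(1\le i\le n),\qquad w_iw_j=q_{ij}^2\,w_jw_i\quad(1\le i,j\le n).$$ Thus $\mathcal A=T(\mathcal A_1)/\langle R\rangle$, where $\mathcal A_1$ is the span of the $w_i$ and $R\subset\mathcal A_1\otimes\mathcal A_1$ is the space of quadratic relations. Let $\varepsilon:\mathcal A\to\mathcal A_0=\mathbb C$ be the augmentation $w_i\mapsto 0$, which makes $\mathcal A_0=\mathbb C$ a (left and right) $\mathcal A$-module, the trivial module, and let $\mathcal A_+=\ker\varepsilon$. Put $W_0=\mathbb C$, $W_1=\mathcal A_1$ and $W_k=\bigcap_{l=0}^{k-2}\mathcal A_1^{\otimes l}\otimes R\otimes\mathcal A_1^{\otimes(k-2-l)}$ for $k\ge2$ (the dual of the degree $k$ component of the Koszul dual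 algebra). The right Koszul complex consists of the free right $\mathcal A$-modules $W_k\otimes\mathcal A$, with the differentials $W_{k+1}\otimes\mathcal A\to W_k\otimes\mathcal A$ induced by $(a_1\otimes\cdots\otimes a_{k+1})\otimes a\mapsto(a_1\otimes\cdots\otimes a_k)\otimes a_{k+1}a$. Then: 1. $\mathcal A$ is regular of dimension $n+1$, that is: (a) the global homological dimension of $\mathcal A$ (the supremum of the projective dimensions of all $\mathcal A$-modules), for right modules as well as for left modules, is equal to $n+1$; (b) $\mathcal A$ is Gorenstein: for the Ext groups of right $\mathcal A$-modules, $\mathrm{Ext}^k(\mathcal A_0,\mathcal A)=0$ for all $k\neq n+1$, and $\mathrm{Ext}^{n+1}(\mathcal A_0,\mathcal A)\cong\mathbb C$, as a left $\mathcal A$-module isomorphic to the trivial module. 2. The right Koszul complex, augmented by $\varepsilon:W_0\otimes\mathcal A=\mathcal A\to\mathcal A_0$, is a minimal free resolution of the trivial right module $\mathcal A_0$: it is exact, its terms are free of finite rank, and the image of each differential $W_{k+1}\otimes\mathcal A\to W_k\otimes\mathcal A$ lies in $W_k\otimes\mathcal A_+$. It has length exactly $n+1$: $W_k\neq0$ if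 and only if $k\le n+1$. -/

import Mathlib

open CategoryTheory MulOpposite
open scoped TensorProduct

noncomputable section

/-! Right modules over `A` are modules over `Aᵐᵒᵖ`. -/

/-- The (left) global dimension of a ring `R`: the supremum of the projective dimensions of all
`R`-modules.  The right global dimension of `R` is `globalDimension Rᵐᵒᵖ`. -/
def globalDimension (R : Type) [Ring R] : WithBot ℕ∞ :=
  ⨆ M : ModuleCat.{0} R, projectiveDimension M

section Augmented

variable {A : Type} [Ring A] [Algebra ℂ A]

/-- The trivial module `ℂ` of an augmented algebra `ε : A → ℂ`, on which `A` acts through `ε`,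
both from the left and from the right. -/
def TrivialModule (_ε : A →ₐ[ℂ] ℂ) : Type := ℂ

namespace TrivialModule

variable (ε : A →ₐ[ℂ] ℂ)

instance : AddCommGroup (TrivialModule ε) := inferInstanceAs (AddCommGroup ℂ)

instance instLeft : Module A (TrivialModule ε) := Module.compHom ℂ (ε : A →+* ℂ)

instance instRight : Module Aᵐᵒᵖ (TrivialModule ε) :=
  Module.compHom ℂ ((ε : A →+* ℂ).fromOpposite fun _ _ => Commute.all _ _)

/-- The augmentation, as a homomorphism of right modules from `A` to the trivial module. -/
def aug : A →ₗ[Aᵐᵒᵖ] TrivialModule ε where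
  toFun a := ε a
  map_add' a b := map_add ε a b
  map_smul' r a := (map_mul ε a r.unop).trans (mul_comm _ _)

end TrivialModule

/-- Left multiplication by `a`, as an endomorphism of the right module `A`. -/
def leftMul (A : Type) [Ring A] (a : A) : A →ₗ[Aᵐᵒᵖ] A where
  toFun x := a * x
  map_add' x y := mul_add a x y
  map_smul' r x := (mul_assoc a x r.unop).symm

/-- `Ext^k(M, A)` in the category of right `A`-modules. -/
def RightExt (A : Type) [Ring A] (M : ModuleCat.{0} Aᵐᵒᵖ) (k : ℕ) : Type :=
  Abelian.Ext M (ModuleCat.of Aᵐᵒᵖ A) k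

namespace RightExt

variable (A : Type) [Ring A] (M : ModuleCat.{0} Aᵐᵒᵖ) (k : ℕ)

instance : AddCommGroup (RightExt A M k) :=
  inferInstanceAs (AddCommGroup (Abelian.Ext M (ModuleCat.of Aᵐᵒᵖ A) k))

/-- The left `A`-module structure on `Ext^k(M, A)` induced by left multiplication on the
second argument. -/
instance : Module A (RightExt A M k) where
  smul a e := Abelian.Ext.comp (Y := ModuleCat.of Aᵐᵒᵖ A) e
    (Abelian.Ext.mk₀ (ModuleCat.ofHom (leftMul A a))) (add_zero k)
  one_smul e := by
    have h : ModuleCat.ofHom (leftMul A (1 : A)) = 𝟙 (ModuleCat.of Aᵐᵒᵖ A) := by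
      refine ModuleCat.hom_ext (LinearMap.ext fun x => ?_); exact one_mul x
    change Abelian.Ext.comp e (Abelian.Ext.mk₀ (ModuleCat.ofHom (leftMul A 1))) (add_zero k) = e
    rw [h]
    exact Abelian.Ext.comp_mk₀_id (C := ModuleCat Aᵐᵒᵖ) e
  mul_smul a b e := by
    have h : ModuleCat.ofHom (leftMul A (a * b)) =
        ModuleCat.ofHom (leftMul A b) ≫ ModuleCat.ofHom (leftMul A a) := by
      refine ModuleCat.hom_ext (LinearMap.ext fun x => ?_); exact mul_assoc a b x
    change Abelian.Ext.comp e (Abelian.Ext.mk₀ (ModuleCat.ofHom (leftMul A (a * b)))) (add_zero k) =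
      Abelian.Ext.comp (Abelian.Ext.comp e
        (Abelian.Ext.mk₀ (ModuleCat.ofHom (leftMul A b))) (add_zero k))
        (Abelian.Ext.mk₀ (ModuleCat.ofHom (leftMul A a))) (add_zero k)
    rw [h, ← Abelian.Ext.mk₀_comp_mk₀]
    exact (Abelian.Ext.comp_assoc_of_third_deg_zero (C := ModuleCat Aᵐᵒᵖ) e _ _ _).symm
  smul_zero a := Abelian.Ext.zero_comp (C := ModuleCat Aᵐᵒᵖ) _ _ _ _ _
  smul_add a e f := Abelian.Ext.add_comp (C := ModuleCat Aᵐᵒᵖ) e f _ _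
  add_smul a b e := by
    have h : ModuleCat.ofHom (leftMul A (a + b)) =
        ModuleCat.ofHom (leftMul A a) + ModuleCat.ofHom (leftMul A b) := by
      refine ModuleCat.hom_ext (LinearMap.ext fun x => ?_); exact add_mul a b x
    change Abelian.Ext.comp e (Abelian.Ext.mk₀ (ModuleCat.ofHom (leftMul A (a + b)))) (add_zero k) =
      Abelian.Ext.comp e (Abelian.Ext.mk₀ (ModuleCat.ofHom (leftMul A a))) (add_zero k) +
      Abelian.Ext.comp e (Abelian.Ext.mk₀ (ModuleCat.ofHom (leftMul A b))) (add_zero k)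
    rw [h, Abelian.Ext.mk₀_add]
    exact Abelian.Ext.comp_add (C := ModuleCat Aᵐᵒᵖ) e _ _ _
  zero_smul e := by
    have h : ModuleCat.ofHom (leftMul A (0 : A)) =
        (0 : ModuleCat.of Aᵐᵒᵖ A ⟶ ModuleCat.of Aᵐᵒᵖ A) := by
      refine ModuleCat.hom_ext (LinearMap.ext fun x => ?_); exact zero_mul x
    change Abelian.Ext.comp e (Abelian.Ext.mk₀ (ModuleCat.ofHom (leftMul A 0))) (add_zero k) = 0
    rw [h, Abelian.Ext.mk₀_zero]
    exact Abelian.Ext.comp_zero (C := ModuleCat Aᵐᵒᵖ) e _ _ _ _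

end RightExt

/-- The Gorenstein property in dimension `d`: `Ext^k(ℂ, A)`, formed with right modules, vanishes
for `k ≠ d`, and for `k = d` it is isomorphic to the trivial left `A`-module `ℂ`. -/
structure IsGorensteinAlgebra (ε : A →ₐ[ℂ] ℂ) (d : ℕ) : Prop where
  ext_eq_zero : ∀ k, k ≠ d →
    Subsingleton (RightExt A (ModuleCat.of Aᵐᵒᵖ (TrivialModule ε)) k)
  ext_top :
    Nonempty (RightExt A (ModuleCat.of Aᵐᵒᵖ (TrivialModule ε)) d ≃ₗ[A] TrivialModule ε)

/-- `A` is regular of dimension `d`: it has finite global dimension `d` (on both sides) and it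
is Gorenstein. -/
structure IsRegularAlgebra (ε : A →ₐ[ℂ] ℂ) (d : ℕ) : Prop where
  right_globalDimension : globalDimension Aᵐᵒᵖ = (d : ℕ∞)
  left_globalDimension : globalDimension A = (d : ℕ∞)
  gorenstein : IsGorensteinAlgebra ε d

/-- The sequence `⋯ → K 2 → K 1 → K 0 → ℂ → 0` of right `A`-modules is a minimal free resolution
of the trivial right module: it is exact, each `K k` is free of finite rank, and the image of each
differential lies in `K k · A₊`, where `A₊ = ker ε`. -/
structure IsMinimalFreeResolution (ε : A →ₐ[ℂ] ℂ) (K : ℕ → Type)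
    [∀ k, AddCommGroup (K k)] [∀ k, Module Aᵐᵒᵖ (K k)]
    (d : ∀ k, K (k + 1) →ₗ[Aᵐᵒᵖ] K k) (η : K 0 →ₗ[Aᵐᵒᵖ] TrivialModule ε) : Prop where
  free : ∀ k, Module.Free Aᵐᵒᵖ (K k)
  finite : ∀ k, Module.Finite Aᵐᵒᵖ (K k)
  surjective : Function.Surjective η
  exact_zero : Function.Exact (d 0) η
  exact_succ : ∀ k, Function.Exact (d (k + 1)) (d k)
  minimal : ∀ k x, d k x ∈
    Submodule.span Aᵐᵒᵖ {y : K k | ∃ (a : A) (z : K k), ε a = 0 ∧ y = op a • z}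

end Augmented

/-! ### Quadratic algebras and their Koszul complexes -/

section Quadratic

variable {ι : Type}

/-- The span of the generators in the free algebra: the first tensor power `V` inside the tensor
algebra `T(V)`, `V` being the vector space with basis `ι`. The `k`-th tensor power of `V` is the
submodule `freeGen ι ^ k`. -/
def freeGen (ι : Type) : Submodule ℂ (FreeAlgebra ℂ ι) :=
  Submodule.span ℂ (Set.range (FreeAlgebra.ι ℂ))

/-- A space of quadratic relations `R ⊆ V ⊗ V`. -/
structure QuadraticData (ι : Type) where
  R : Submodule ℂ (FreeAlgebra ℂ ι)
  R_le : R ≤ freeGen ι ^ 2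

/-- The linear map `∂ᵢ` on the tensor algebra removing a last letter `i`: it sends a word `u i`
to `u`, and all other words to `0`. -/
def dropLast [DecidableEq ι] (i : ι) : FreeAlgebra ℂ ι →ₗ[ℂ] FreeAlgebra ℂ ι :=
  (FreeAlgebra.basisFreeMonoid ℂ ι).constr ℂ fun u =>
    if u.toList.getLast? = some i then
      FreeAlgebra.basisFreeMonoid ℂ ι (FreeMonoid.ofList u.toList.dropLast)
    else 0

namespace QuadraticData

variable (Q : QuadraticData ι)

/-- The quadratic algebra `A = T(V) / ⟨R⟩`. -/
def Alg : Type := RingQuot fun x y : FreeAlgebra ℂ ι => x ∈ Q.R ∧ y = 0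

instance : Ring Q.Alg :=
  inferInstanceAs (Ring (RingQuot fun x y : FreeAlgebra ℂ ι => x ∈ Q.R ∧ y = 0))

instance : Algebra ℂ Q.Alg :=
  inferInstanceAs (Algebra ℂ (RingQuot fun x y : FreeAlgebra ℂ ι => x ∈ Q.R ∧ y = 0))

/-- The projection `T(V) → A`. -/
def proj : FreeAlgebra ℂ ι →ₐ[ℂ] Q.Alg :=
  RingQuot.mkAlgHom ℂ fun x y : FreeAlgebra ℂ ι => x ∈ Q.R ∧ y = 0

/-- The generators of `A`. -/
def gen (i : ι) : Q.Alg := Q.proj (FreeAlgebra.ι ℂ i)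

theorem algebraMapInv_eq_zero {x : FreeAlgebra ℂ ι} (hx : x ∈ freeGen ι ^ 2) :
    (FreeAlgebra.algebraMapInv x : ℂ) = 0 := by
  rw [pow_two] at hx
  refine Submodule.mul_induction_on hx (fun a ha b _ => ?_) fun a b ha hb => by
    rw [map_add, ha, hb, add_zero]
  have h : (FreeAlgebra.algebraMapInv a : ℂ) = 0 := by
    refine Submodule.span_induction ?_ (map_zero _) (fun y z _ _ hy hz => by
      rw [map_add, hy, hz, add_zero]) (fun c y _ hy => by rw [map_smul, hy, smul_zero]) ha
    rintro _ ⟨i, rfl⟩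
    simp [FreeAlgebra.algebraMapInv]
  rw [map_mul, h, zero_mul]

/-- The augmentation `ε : A → A₀ = ℂ`, the algebra homomorphism killing the generators. -/
def augmentation : Q.Alg →ₐ[ℂ] ℂ :=
  RingQuot.liftAlgHom ℂ ⟨FreeAlgebra.algebraMapInv, fun x y h => by
    rw [algebraMapInv_eq_zero (Q.R_le h.1), h.2, map_zero]⟩

/-- The space `W k = ⋂_{l + m + 2 = k} V^{⊗ l} ⊗ R ⊗ V^{⊗ m} ⊆ V^{⊗ k}`, dual to the degree `k`
component of the Koszul dual algebra; `W 0 = ℂ`, `W 1 = V` and `W 2 = R`. -/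
def koszulSpace (k : ℕ) : Submodule ℂ (FreeAlgebra ℂ ι) :=
  freeGen ι ^ k ⊓
    ⨅ p : ℕ × ℕ, ⨅ _ : p.1 + p.2 + 2 = k, freeGen ι ^ p.1 * Q.R * freeGen ι ^ p.2

/-- The free right `A`-module `W k ⊗ A` of the Koszul complex (the tensor product over `ℂ` is
written in the order `A ⊗ W k`, and `A` acts by right multiplication on the factor `A`). -/
abbrev koszul (k : ℕ) : Type := Q.Alg ⊗[ℂ] Q.koszulSpace k

/-- The augmentation `W 0 ⊗ A = A → ℂ`. -/
def koszulAug : Q.koszul 0 →ₗ[Q.Algᵐᵒᵖ] TrivialModule Q.augmentation :=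
  TrivialModule.aug Q.augmentation ∘ₗ
    (TensorProduct.AlgebraTensorModule.rid ℂ Q.Algᵐᵒᵖ Q.Alg).toLinearMap ∘ₗ
    TensorProduct.AlgebraTensorModule.map LinearMap.id
      ((FreeAlgebra.algebraMapInv : FreeAlgebra ℂ ι →ₐ[ℂ] ℂ).toLinearMap ∘ₗ
        (Q.koszulSpace 0).subtype)

variable [DecidableEq ι]

theorem dropLast_mul_gen (i j : ι) (x : FreeAlgebra ℂ ι) :
    dropLast i (x * FreeAlgebra.ι ℂ j) = if j = i then x else 0 := by
  have hb : ∀ u : FreeMonoid ι, FreeAlgebra.basisFreeMonoid ℂ ι u * FreeAlgebra.ι ℂ j =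
      FreeAlgebra.basisFreeMonoid ℂ ι (u * FreeMonoid.of j) := by
    intro u
    simp [FreeAlgebra.basisFreeMonoid, FreeAlgebra.equivMonoidAlgebraFreeMonoid]
  have h : dropLast i ∘ₗ LinearMap.mulRight ℂ (FreeAlgebra.ι ℂ j) =
      if j = i then LinearMap.id else 0 := by
    refine (FreeAlgebra.basisFreeMonoid ℂ ι).ext fun u => ?_
    have hd : dropLast i (FreeAlgebra.basisFreeMonoid ℂ ι (u * FreeMonoid.of j)) =
        if j = i then FreeAlgebra.basisFreeMonoid ℂ ι u else 0 := by
      simp [dropLast, Module.Basis.constr_basis]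
    rw [LinearMap.comp_apply, LinearMap.mulRight_apply, hb, hd]
    split_ifs <;> rfl
  have := LinearMap.congr_fun h x
  rw [LinearMap.comp_apply, LinearMap.mulRight_apply] at this
  rw [this]
  split_ifs <;> rfl

theorem dropLast_mem {P : Submodule ℂ (FreeAlgebra ℂ ι)} (i : ι) {x : FreeAlgebra ℂ ι}
    (hx : x ∈ P * freeGen ι) : dropLast i x ∈ P := by
  refine Submodule.mul_induction_on hx (fun a ha b hb => ?_) fun a b ha hb => by
    rw [map_add]; exact P.add_mem ha hb
  refine Submodule.span_induction ?_ (by simp) (fun y z _ _ hy hz => by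
      rw [mul_add, map_add]; exact P.add_mem hy hz)
    (fun c y _ hy => by rw [mul_smul_comm, map_smul]; exact P.smul_mem c hy) hb
  rintro _ ⟨j, rfl⟩
  rw [dropLast_mul_gen]
  split_ifs
  exacts [ha, P.zero_mem]

theorem dropLast_mem_koszulSpace (i : ι) (k : ℕ) {x : FreeAlgebra ℂ ι}
    (hx : x ∈ Q.koszulSpace (k + 1)) : dropLast i x ∈ Q.koszulSpace k := by
  simp only [koszulSpace, Submodule.mem_inf, Submodule.mem_iInf] at hx ⊢
  refine ⟨dropLast_mem i (by rw [← pow_succ]; exact hx.1), fun p hp => dropLast_mem i ?_⟩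
  rw [mul_assoc, ← pow_succ]
  exact hx.2 (p.1, p.2 + 1) (by simp only; omega)

/-- The differential `W (k+1) ⊗ A → W k ⊗ A`, induced by
`(a₁ ⊗ ⋯ ⊗ a_{k+1}) ⊗ a ↦ (a₁ ⊗ ⋯ ⊗ a_k) ⊗ a_{k+1} a`. -/
def koszulD [Fintype ι] (k : ℕ) : Q.koszul (k + 1) →ₗ[Q.Algᵐᵒᵖ] Q.koszul k :=
  ∑ i : ι, TensorProduct.AlgebraTensorModule.map (leftMul Q.Alg (Q.gen i))
    ((dropLast i).restrict fun _ hx => Q.dropLast_mem_koszulSpace i k hx)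

end QuadraticData

end Quadratic

/-! ### The homogeneous coordinate algebra of `ℂℙⁿ_θ` -/

section ProjectiveSpace

variable {n : ℕ}

/-- The `(n+1) × (n+1)` block matrix with blocks `θ, 0, 0, 0`. -/
def thetaTilde (θ : Matrix (Fin n) (Fin n) ℂ) : Matrix (Fin (n + 1)) (Fin (n + 1)) ℂ :=
  fun i j => if h : (i : ℕ) < n ∧ (j : ℕ) < n then θ ⟨i, h.1⟩ ⟨j, h.2⟩ else 0

/-- The parameters `q_{ij} = exp((i/2) θ_{ij})`. -/
def qParam (θ : Matrix (Fin n) (Fin n) ℂ) (i j : Fin (n + 1)) : ℂ :=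
  Complex.exp (Complex.I / 2 * thetaTilde θ i j)

/-- The quadratic relations `w_i w_j = q_{ij}² w_j w_i` of the homogeneous coordinate algebra of
the noncommutative projective space `ℂℙⁿ_θ`; since `q_{ij} = 1` when `i` or `j` is the last index,
the last generator is central. -/
def projectiveSpace (θ : Matrix (Fin n) (Fin n) ℂ) : QuadraticData (Fin (n + 1)) where
  R := Submodule.span ℂ (Set.range fun p : Fin (n + 1) × Fin (n + 1) =>
    FreeAlgebra.ι ℂ p.1 * FreeAlgebra.ι ℂ p.2 -
      qParam θ p.1 p.2 ^ 2 • (FreeAlgebra.ι ℂ p.2 * FreeAlgebra.ι ℂ p.1))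
  R_le := by
    have h : ∀ i j : Fin (n + 1),
        FreeAlgebra.ι ℂ i * FreeAlgebra.ι ℂ j ∈ freeGen (Fin (n + 1)) ^ 2 := fun i j => by
      rw [pow_two]
      exact Submodule.mul_mem_mul (Submodule.subset_span ⟨i, rfl⟩) (Submodule.subset_span ⟨j, rfl⟩)
    rw [Submodule.span_le]
    rintro _ ⟨p, rfl⟩
    exact Submodule.sub_mem _ (h _ _) (Submodule.smul_mem _ _ (h _ _))

end ProjectiveSpace

end

noncomputable section

/-! ### Universal property and generation of quadratic algebras. -/

namespace QuadraticData

variable {ι : Type} (Q : QuadraticData ι)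

/-! Only `q i j * q j i = 1` and `q i i = 1` matter, so the argument takes place in an arbitrary
quantum affine space with `d` generators; the theorem is the case `d = n + 1`. Normalized monomials
indexed by multisets form a basis, on which multiplication by a generator on either side is a shift
up to nonzero scalars.

Upper bound for the global dimension: `A` is an Ore extension, by `w_j`, of the subalgebra of the
other generators. Every module `M` is therefore the cokernel of an injective map `M[y] → M[y]`
between (twisted) modules induced from that subalgebra (`inducedRel`, `inducedProj`). Forgetting one
generator costs one unit of projective dimension, and once all are forgotten only complex vector
spaces are left (`RelProjective.hasProjectiveDimensionLT`).

Gorenstein property: the generators form a regular normalizing sequence. Left multiplication by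
`w_j` is injective on `A / (w_i : i ∈ s)` for `j ∉ s`, with cokernel `A / (w_i : i ∈ s ∪ {j})`.
Starting from `Hom(A, A) = A`, each long exact sequence raises the only nonzero Ext degree by one
and divides out one more generator (`ExtConcentrated.insert`); the end is `Ext^d(ℂ, A) = A / A₊ =
ℂ`. This group being nonzero bounds the right global dimension from below. The opposite algebra is
again a quantum affine space, with transposed parameters, which settles the left side.

Koszul complex: `W k` has a basis of twisted antisymmetric tensors `e_S` with `|S| = k`
(`altBasis`), so it is nonzero exactly for `k ≤ d`. In the basis `w^a ⊗ e_S` the differential moves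
an index from `S` to `a` and preserves the multidegree `a + S`. Moving one fixed index of the
multidegree back is a contracting homotopy away from multidegree zero (`homotopy`). Minimality holds
because each term of the differential multiplies by a generator. -/

theorem proj_surjective : Function.Surjective Q.proj :=
  RingQuot.mkAlgHom_surjective ℂ _

theorem proj_eq_zero {x : FreeAlgebra ℂ ι} (hx : x ∈ Q.R) : Q.proj x = 0 :=
  (RingQuot.mkAlgHom_rel ℂ (s := fun x y : FreeAlgebra ℂ ι => x ∈ Q.R ∧ y = 0) ⟨hx, rfl⟩).trans
    (map_zero _)

/-- The universal property of the quadratic algebra `T(V) / ⟨R⟩`. -/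
def lift {E : Type*} [Ring E] [Algebra ℂ E] (y : ι → E)
    (hy : ∀ x ∈ Q.R, FreeAlgebra.lift ℂ y x = 0) : Q.Alg →ₐ[ℂ] E :=
  RingQuot.liftAlgHom ℂ ⟨FreeAlgebra.lift ℂ y, fun x _ h => by rw [hy x h.1, h.2, map_zero]⟩

@[simp] theorem lift_gen {E : Type*} [Ring E] [Algebra ℂ E] (y : ι → E)
    (hy : ∀ x ∈ Q.R, FreeAlgebra.lift ℂ y x = 0) (i : ι) : Q.lift y hy (Q.gen i) = y i :=
  (RingQuot.liftAlgHom_mkAlgHom_apply ..).trans (FreeAlgebra.lift_ι_apply ..)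

@[simp] theorem augmentation_gen (i : ι) : Q.augmentation (Q.gen i) = 0 :=
  (RingQuot.liftAlgHom_mkAlgHom_apply ..).trans (by simp [FreeAlgebra.algebraMapInv])

/-- An induction principle: the quadratic algebra is generated by its generators. -/
theorem gen_induction {P : Q.Alg → Prop} (hc : ∀ c, P (algebraMap ℂ Q.Alg c))
    (hg : ∀ i, P (Q.gen i)) (hm : ∀ a b, P a → P b → P (a * b))
    (ha : ∀ a b, P a → P b → P (a + b)) (a : Q.Alg) : P a := by
  obtain ⟨x, rfl⟩ := Q.proj_surjective a
  induction x using FreeAlgebra.induction with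
  | grade0 c => rw [AlgHom.commutes]; exact hc c
  | grade1 i => exact hg i
  | mul a b h₁ h₂ => rw [map_mul]; exact hm _ _ h₁ h₂
  | add a b h₁ h₂ => rw [map_add]; exact ha _ _ h₁ h₂

end QuadraticData

/-! ### Quantum affine spaces -/

section Quantum

variable {ι : Type}

/-- Parameters `q_{ij}` of a quantum affine space: a multiplicatively skew-symmetric matrix. -/
structure IsSkewParam (q : ι → ι → ℂ) : Prop where
  mul_swap : ∀ i j, q i j * q j i = 1
  diag : ∀ i, q i i = 1

theorem IsSkewParam.ne_zero {q : ι → ι → ℂ} (hq : IsSkewParam q) (i j : ι) : q i j ≠ 0 :=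
  left_ne_zero_of_mul_eq_one (hq.mul_swap i j)

theorem IsSkewParam.inv_eq {q : ι → ι → ℂ} (hq : IsSkewParam q) (i j : ι) :
    (q i j)⁻¹ = q j i :=
  inv_eq_of_mul_eq_one_right (hq.mul_swap i j)

theorem IsSkewParam.swap {q : ι → ι → ℂ} (hq : IsSkewParam q) :
    IsSkewParam fun i j => q j i :=
  ⟨fun i j => hq.mul_swap j i, hq.diag⟩

/-- The quadratic relations `w_i w_j = q_{ij}² w_j w_i` of a quantum affine space. -/
def quantumSpace (q : ι → ι → ℂ) : QuadraticData ι where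
  R := Submodule.span ℂ (Set.range fun p : ι × ι =>
    FreeAlgebra.ι ℂ p.1 * FreeAlgebra.ι ℂ p.2 -
      q p.1 p.2 ^ 2 • (FreeAlgebra.ι ℂ p.2 * FreeAlgebra.ι ℂ p.1))
  R_le := by
    have h : ∀ i j : ι, FreeAlgebra.ι ℂ i * FreeAlgebra.ι ℂ j ∈ freeGen ι ^ 2 := fun i j => by
      rw [pow_two]
      exact Submodule.mul_mem_mul (Submodule.subset_span ⟨i, rfl⟩) (Submodule.subset_span ⟨j, rfl⟩)
    rw [Submodule.span_le]
    rintro _ ⟨p, rfl⟩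
    exact Submodule.sub_mem _ (h _ _) (Submodule.smul_mem _ _ (h _ _))

namespace quantumSpace

variable {q : ι → ι → ℂ}

/-- The coordinate algebra of a quantum affine space. -/
abbrev QAlg (q : ι → ι → ℂ) : Type := (quantumSpace q).Alg

/-- The generators of the coordinate algebra. -/
abbrev X (q : ι → ι → ℂ) (i : ι) : QAlg q := (quantumSpace q).gen i

theorem X_mul_X (q : ι → ι → ℂ) (i j : ι) : X q i * X q j = q i j ^ 2 • (X q j * X q i) := by
  have := (quantumSpace q).proj_eq_zero (Submodule.subset_span ⟨(i, j), rfl⟩)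
  rw [map_sub, map_smul, map_mul, map_mul, sub_eq_zero] at this
  exact this

/-- The universal property of the coordinate algebra of a quantum affine space. -/
def qlift {E : Type*} [Ring E] [Algebra ℂ E] (y : ι → E)
    (hy : ∀ i j, y i * y j = q i j ^ 2 • (y j * y i)) : QAlg q →ₐ[ℂ] E :=
  (quantumSpace q).lift y fun x hx => by
    induction hx using Submodule.span_induction with
    | mem x h =>
      obtain ⟨p, rfl⟩ := h
      simp only [map_sub, map_smul, map_mul, FreeAlgebra.lift_ι_apply]
      rw [hy, sub_self]
    | zero => exact map_zero _
    | add x y _ _ hx hy => rw [map_add, hx, hy, add_zero]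
    | smul c x _ hx => rw [map_smul, hx, smul_zero]

@[simp] theorem qlift_X {E : Type*} [Ring E] [Algebra ℂ E] (y : ι → E)
    (hy : ∀ i j, y i * y j = q i j ^ 2 • (y j * y i)) (i : ι) : qlift y hy (X q i) = y i :=
  (quantumSpace q).lift_gen ..

/-- The product `∏_{j ∈ t} q_{ij}` over a multiset `t`. -/
def weight (q : ι → ι → ℂ) (i : ι) (t : Multiset ι) : ℂ := (t.map (q i)).prod

@[simp] theorem weight_zero (i : ι) : weight q i 0 = 1 := by simp [weight]

@[simp] theorem weight_cons (i j : ι) (t : Multiset ι) :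
    weight q i (j ::ₘ t) = q i j * weight q i t := by simp [weight]

theorem weight_ne_zero (hq : IsSkewParam q) (i : ι) (t : Multiset ι) : weight q i t ≠ 0 := by
  induction t using Multiset.induction with
  | empty => simp
  | cons j t ih => rw [weight_cons]; exact mul_ne_zero (hq.ne_zero i j) ih

/-- The step in the construction of the monomials. -/
def monStep (q : ι → ι → ℂ) (i : ι) (p : Multiset ι × QAlg q) : Multiset ι × QAlg q :=
  (i ::ₘ p.1, (weight q i p.1)⁻¹ • (X q i * p.2))

/-- The normalization splits `q i j ^ 2` evenly: `(q i j)⁻¹ w_i w_j = q i j w_j w_i = (q j i)⁻¹ w_j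
w_i`. Hence a monomial depends only on the multiset of its letters, and no order on `ι` has to be
chosen. -/
theorem monStep_comm (hq : IsSkewParam q) : LeftCommutative (monStep q) where
  left_comm i j p := by
    refine Prod.ext (Multiset.cons_swap ..) ?_
    have hi := hq.ne_zero i j
    have h : q j i = (q i j)⁻¹ := (hq.inv_eq i j).symm
    simp only [monStep, weight_cons, mul_smul_comm, smul_smul, ← mul_assoc]
    rw [X_mul_X q i j, smul_mul_assoc, smul_smul, h]
    congr 1
    field_simp

/-- The normalized monomials of a quantum affine space. -/
def mon (hq : IsSkewParam q) (t : Multiset ι) : QAlg q :=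
  haveI := monStep_comm hq
  (t.foldr (monStep q) (0, 1)).2

variable (hq : IsSkewParam q)

@[simp] theorem mon_zero : mon hq 0 = 1 := rfl

theorem mon_cons (i : ι) (t : Multiset ι) :
    mon hq (i ::ₘ t) = (weight q i t)⁻¹ • (X q i * mon hq t) := by
  have := monStep_comm hq
  have h : ∀ t : Multiset ι, (t.foldr (monStep q) (0, 1)).1 = t := fun t => by
    induction t using Multiset.induction with
    | empty => rfl
    | cons j t ih => rw [Multiset.foldr_cons, monStep, ih]
  rw [mon, Multiset.foldr_cons, monStep, h, mon]

theorem X_mul_mon (i : ι) (t : Multiset ι) :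
    X q i * mon hq t = weight q i t • mon hq (i ::ₘ t) := by
  rw [mon_cons, smul_smul, mul_inv_cancel₀ (weight_ne_zero hq i t), one_smul]

/-- Left and right multiplication by a generator produce the same monomial with inverse scalars, so
regularity and divisibility can be read off on both sides. -/
theorem mon_mul_X (i : ι) (t : Multiset ι) :
    mon hq t * X q i = (weight q i t)⁻¹ • mon hq (i ::ₘ t) := by
  induction t using Multiset.induction with
  | empty => rw [mon_cons]; simp
  | cons j t ih =>
    rw [mon_cons, smul_mul_assoc, mul_assoc, ih, mul_smul_comm, X_mul_mon, smul_smul, smul_smul,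
      weight_cons, weight_cons, Multiset.cons_swap]
    congr 1
    have := hq.ne_zero i j
    have := weight_ne_zero hq j t
    have := weight_ne_zero hq i t
    rw [← hq.inv_eq i j]
    field_simp

/-- The action of the generators on the space with basis the monomials. -/
def monAct (q : ι → ι → ℂ) (i : ι) : Module.End ℂ (Multiset ι →₀ ℂ) :=
  Finsupp.lift _ ℂ _ fun t => Finsupp.single (i ::ₘ t) (weight q i t)

theorem monAct_single (i : ι) (t : Multiset ι) (c : ℂ) :
    monAct q i (Finsupp.single t c) = Finsupp.single (i ::ₘ t) (c * weight q i t) := by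
  simp [monAct]

/-- The coordinates of an element with respect to the normalized monomials. -/
def coord : QAlg q →ₗ[ℂ] Multiset ι →₀ ℂ :=
  LinearMap.applyₗ (Finsupp.single 0 1) ∘ₗ (qlift (monAct q) fun i j => by
    have hi := hq.ne_zero i j
    refine Finsupp.lhom_ext fun t c => ?_
    simp only [Module.End.mul_apply, LinearMap.smul_apply, monAct_single, weight_cons,
      Finsupp.smul_single, Multiset.cons_swap i j, ← hq.inv_eq i j, smul_eq_mul]
    congr 1
    field_simp).toLinearMap

/-- The algebra acts on the vector space freely spanned by multisets, and applying a monomial to the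
vacuum vector recovers its multiset. This gives linear independence. -/
theorem coord_mon (t : Multiset ι) : coord hq (mon hq t) = Finsupp.single t 1 := by
  induction t using Multiset.induction with
  | empty => simp [coord]
  | cons i t ih =>
    have h : coord hq (X q i * mon hq t) = monAct q i (coord hq (mon hq t)) := by
      simp [coord]
    rw [mon_cons, map_smul, h, ih, monAct_single, Finsupp.smul_single, one_mul, smul_eq_mul,
      inv_mul_cancel₀ (weight_ne_zero hq i t)]

/-- The span is stable under left multiplication by the generators and contains `1`. -/
theorem span_mon : Submodule.span ℂ (Set.range (mon hq)) = ⊤ := by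
  have key : ∀ a : QAlg q, ∀ b ∈ Submodule.span ℂ (Set.range (mon hq)),
      a * b ∈ Submodule.span ℂ (Set.range (mon hq)) := fun a => by
    induction a using (quantumSpace q).gen_induction with
    | hc c => exact fun b hb => by rw [← Algebra.smul_def]; exact Submodule.smul_mem _ _ hb
    | hg i =>
      intro b hb
      induction hb using Submodule.span_induction with
      | mem x h =>
        obtain ⟨t, rfl⟩ := h
        rw [X_mul_mon]
        exact Submodule.smul_mem _ _ (Submodule.subset_span ⟨_, rfl⟩)
      | zero => rw [mul_zero]; exact zero_mem _
      | add x y _ _ hx hy => rw [mul_add]; exact add_mem hx hy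
      | smul c x _ hx => rw [mul_smul_comm]; exact Submodule.smul_mem _ _ hx
    | hm a b ha hb => exact fun c hc => by rw [mul_assoc]; exact ha _ (hb _ hc)
    | ha a b ha hb => exact fun c hc => by rw [add_mul]; exact add_mem (ha _ hc) (hb _ hc)
  refine eq_top_iff.2 fun a _ => ?_
  rw [← mul_one a]
  exact key a 1 (Submodule.subset_span ⟨0, rfl⟩)

theorem linearIndependent_mon : LinearIndependent ℂ (mon hq) := by
  refine LinearIndependent.of_comp (coord hq) ?_
  have : coord hq ∘ mon hq = fun t => Finsupp.single t 1 := funext (coord_mon hq)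
  rw [this]
  exact Finsupp.linearIndependent_single_one ℂ _

/-- The basis of normalized monomials. -/
def monBasis : Module.Basis (Multiset ι) ℂ (QAlg q) :=
  Module.Basis.mk (linearIndependent_mon hq) (span_mon hq).ge

@[simp] theorem monBasis_apply (t : Multiset ι) : monBasis hq t = mon hq t := by simp [monBasis]

end quantumSpace

end Quantum

/-! ### The global dimension of a quantum affine space -/

namespace quantumSpace

variable {ι : Type} {q : ι → ι → ℂ}

/-- A map which commutes with the generators up to the scalars `l i`, for `i ∈ s`. -/
def TwistedLinear (q : ι → ι → ℂ) (s : Set ι) (l : ι → ℂ) {M N : Type} [AddCommGroup M]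
    [Module ℂ M] [Module (QAlg q) M] [AddCommGroup N] [Module ℂ N] [Module (QAlg q) N]
    (f : M →ₗ[ℂ] N) : Prop :=
  ∀ i ∈ s, ∀ m, f (X q i • m) = l i • X q i • f m

/-- A module `M` is projective relative to the generators in `s` if maps out of `M` which are
twisted linear with respect to these generators lift along surjective homomorphisms. -/
def RelProjective (q : ι → ι → ℂ) (s : Set ι) (M : Type) [AddCommGroup M] [Module ℂ M]
    [Module (QAlg q) M] : Prop :=
  ∀ (l : ι → ℂ) (N N' : Type) [AddCommGroup N] [Module ℂ N] [Module (QAlg q) N]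
    [IsScalarTower ℂ (QAlg q) N] [AddCommGroup N'] [Module ℂ N'] [Module (QAlg q) N']
    [IsScalarTower ℂ (QAlg q) N'] (g : N →ₗ[QAlg q] N') (f : M →ₗ[ℂ] N'),
    Function.Surjective g → TwistedLinear q s l f →
    ∃ F : M →ₗ[ℂ] N, TwistedLinear q s l F ∧ ∀ m, g (F m) = f m

/-- With no generator to respect, a complex linear section of the surjection suffices. -/
theorem relProjective_empty (M : Type) [AddCommGroup M] [Module ℂ M] [Module (QAlg q) M] :
    RelProjective q ∅ M := by
  intro l N N' _ _ _ _ _ _ _ _ g f hg _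
  obtain ⟨h, hh⟩ := (g.restrictScalars ℂ).exists_rightInverse_of_surjective
    (LinearMap.range_eq_top.2 hg)
  exact ⟨h ∘ₗ f, fun i hi => hi.elim, fun m => LinearMap.congr_fun hh (f m)⟩

/-- A map which commutes with all generators is a homomorphism of modules. -/
theorem TwistedLinear.map_smul' {M N : Type} [AddCommGroup M]
    [Module ℂ M] [Module (QAlg q) M] [IsScalarTower ℂ (QAlg q) M] [AddCommGroup N] [Module ℂ N]
    [Module (QAlg q) N] [IsScalarTower ℂ (QAlg q) N] {f : M →ₗ[ℂ] N}
    (hf : TwistedLinear q Set.univ 1 f) (a : QAlg q) (m : M) : f (a • m) = a • f m := by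
  induction a using (quantumSpace q).gen_induction generalizing m with
  | hc c => rw [algebraMap_smul, algebraMap_smul, map_smul]
  | hg i => rw [hf i trivial, Pi.one_apply, one_smul]
  | hm a b h₁ h₂ => rw [mul_smul, mul_smul, h₁, h₂]
  | ha a b h₁ h₂ => rw [add_smul, add_smul, map_add, h₁, h₂]

theorem RelProjective.projective {M : Type} [AddCommGroup M] [Module ℂ M] [Module (QAlg q) M]
    [IsScalarTower ℂ (QAlg q) M] (hM : RelProjective q Set.univ M) :
    Projective (ModuleCat.of (QAlg q) M) where
  factors {E Y} f e he := by
    let _ : Module ℂ E := Module.compHom E (algebraMap ℂ (QAlg q))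
    let _ : Module ℂ Y := Module.compHom Y (algebraMap ℂ (QAlg q))
    have : IsScalarTower ℂ (QAlg q) E := .of_algebraMap_smul fun _ _ => rfl
    have : IsScalarTower ℂ (QAlg q) Y := .of_algebraMap_smul fun _ _ => rfl
    obtain ⟨F, hF, h⟩ := hM 1 E Y e.hom (f.hom.restrictScalars ℂ)
      ((ModuleCat.epi_iff_surjective e).1 he) fun i _ m => by simp
    refine ⟨ModuleCat.ofHom { F with map_smul' := hF.map_smul' }, ?_⟩
    ext m
    exact h m

/-! ### Modules induced from the subalgebra omitting one generator. -/

section Basic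

variable (hq : IsSkewParam q) (j : ι) (e : ℕ) (M : Type) [AddCommGroup M] [Module ℂ M]

/-- The module `M[y]` induced from the subalgebra generated by the `w_i`, `i ≠ j`, with a twist by
the `e`-th power of an automorphism. -/
def Induced (_hq : IsSkewParam q) (_j : ι) (_e : ℕ) (M : Type) [AddCommGroup M] : Type := ℕ →₀ M

instance : AddCommGroup (Induced hq j e M) := inferInstanceAs (AddCommGroup (ℕ →₀ M))

instance : Module ℂ (Induced hq j e M) := inferInstanceAs (Module ℂ (ℕ →₀ M))

/-- The element `y^k m`. -/
def Induced.single (k : ℕ) : M →ₗ[ℂ] Induced hq j e M := Finsupp.lsingle k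

variable {M}

theorem Induced.hom_ext {N : Type} [AddCommGroup N] [Module ℂ N] {f g : Induced hq j e M →ₗ[ℂ] N}
    (h : ∀ k m, f (single hq j e M k m) = g (single hq j e M k m)) : f = g :=
  Finsupp.lhom_ext h

/-- The linear map out of `M[y]` with given values on the `y^k m`. -/
def Induced.desc {N : Type} [AddCommGroup N] [Module ℂ N] (f : ℕ → M →ₗ[ℂ] N) :
    Induced hq j e M →ₗ[ℂ] N := Finsupp.lsum ℂ f

@[simp] theorem Induced.desc_single {N : Type} [AddCommGroup N] [Module ℂ N]
    (f : ℕ → M →ₗ[ℂ] N) (k : ℕ) (m : M) : desc hq j e f (single hq j e M k m) = f k m :=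
  Finsupp.lsum_single ..

theorem Induced.induction {P : Induced hq j e M → Prop} (f : Induced hq j e M) (h0 : P 0)
    (ha : ∀ f g, P f → P g → P (f + g)) (hs : ∀ k m, P (single hq j e M k m)) : P f :=
  Finsupp.induction_linear f h0 ha hs

/-- The coefficient of `y^k`. -/
def Induced.coeff (k : ℕ) : Induced hq j e M →ₗ[ℂ] M := Finsupp.lapply k

theorem Induced.coeff_single (k n : ℕ) (m : M) :
    coeff hq j e k (single hq j e M n m) = if n = k then m else 0 :=
  Finsupp.single_apply

end Basic

section Induced

variable (hq : IsSkewParam q) (j : ι) (e : ℕ) (M : Type) [AddCommGroup M] [Module ℂ M]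
  [Module (QAlg q) M] [IsScalarTower ℂ (QAlg q) M]

open Classical in
/-- The action of the generators on the polynomials in one variable `y` with coefficients in `M`:
`w_j` acts by multiplication by `y`, and `w_i (y^k m) = q_{ij}^{2(k+e)} y^k (w_i m)` for `i ≠ j`. -/
def inducedAct (i : ι) : Module.End ℂ (ℕ →₀ M) :=
  if i = j then Finsupp.lmapDomain M ℂ Nat.succ
  else Finsupp.lsum ℂ fun k =>
    Finsupp.lsingle k ∘ₗ ((q i j ^ 2) ^ (k + e) • Module.toModuleEnd ℂ (S := QAlg q) M (X q i))

variable {M} in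
theorem inducedAct_self (k : ℕ) (m : M) :
    inducedAct (q := q) j e M j (Finsupp.single k m) = Finsupp.single (k + 1) m := by
  simp [inducedAct]

variable {M} in
theorem inducedAct_of_ne {i : ι} (h : i ≠ j) (k : ℕ) (m : M) :
    inducedAct (q := q) j e M i (Finsupp.single k m) =
      Finsupp.single k ((q i j ^ 2) ^ (k + e) • X q i • m) := by
  simp [inducedAct, h]

theorem inducedAct_mul_inducedAct (hq : IsSkewParam q) (i i' : ι) :
    inducedAct (q := q) j e M i * inducedAct (q := q) j e M i' =
    q i i' ^ 2 • (inducedAct (q := q) j e M i' * inducedAct (q := q) j e M i) := by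
  have hX : ∀ m : M, X q i • X q i' • m = q i i' ^ 2 • X q i' • X q i • m := fun m => by
    rw [← mul_smul, X_mul_X q i i', smul_assoc, mul_smul]
  refine Finsupp.lhom_ext fun k m => ?_
  rw [LinearMap.smul_apply, Module.End.mul_apply, Module.End.mul_apply]
  by_cases hi : i = j <;> by_cases hi' : i' = j
  · subst hi hi'
    simp [hq.diag]
  · subst hi
    have h : q i i' * q i' i = 1 := hq.mul_swap _ _
    rw [inducedAct_self, inducedAct_of_ne _ _ hi', inducedAct_of_ne _ _ hi', inducedAct_self,
      Finsupp.smul_single, smul_smul, add_right_comm, pow_succ' (q i' i ^ 2), ← mul_assoc,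
      ← mul_pow, h, one_pow, one_mul]
  · subst hi'
    rw [inducedAct_self, inducedAct_of_ne _ _ hi, inducedAct_of_ne _ _ hi, inducedAct_self,
      Finsupp.smul_single, smul_smul, add_right_comm, pow_succ' (q i i' ^ 2)]
  · simp only [inducedAct_of_ne _ _ hi, inducedAct_of_ne _ _ hi', Finsupp.smul_single]
    congr 1
    rw [smul_algebra_smul_comm _ (X q i), smul_algebra_smul_comm _ (X q i'), hX]
    simp only [smul_smul]
    congr 1
    ring

/-- The action of the algebra on `M[y]`. -/
def inducedHom : QAlg q →ₐ[ℂ] Module.End ℂ (Induced hq j e M) :=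
  qlift (E := Module.End ℂ (ℕ →₀ M)) (inducedAct j e M) (inducedAct_mul_inducedAct j e M hq)

instance : Module (QAlg q) (Induced hq j e M) :=
  Module.compHom (Induced hq j e M) (inducedHom hq j e M).toRingHom

instance : IsScalarTower ℂ (QAlg q) (Induced hq j e M) :=
  .of_algebraMap_smul fun c m =>
    LinearMap.congr_fun ((inducedHom hq j e M).commutes c) m

variable {M}

theorem Induced.X_smul_single_self (k : ℕ) (m : M) :
    X q j • single hq j e M k m = single hq j e M (k + 1) m :=
  (LinearMap.congr_fun (qlift_X (E := Module.End ℂ (ℕ →₀ M)) _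
    (inducedAct_mul_inducedAct j e M hq) j) _).trans (inducedAct_self ..)

theorem Induced.X_smul_single_of_ne {i : ι} (h : i ≠ j) (k : ℕ) (m : M) :
    X q i • single hq j e M k m = single hq j e M k ((q i j ^ 2) ^ (k + e) • X q i • m) :=
  (LinearMap.congr_fun (qlift_X (E := Module.End ℂ (ℕ →₀ M)) _
    (inducedAct_mul_inducedAct j e M hq) i) _).trans (inducedAct_of_ne _ _ h ..)

/-- Twisted linearity may be checked on the elements `y^k m`. -/
theorem Induced.twistedLinear_of_single {N : Type} [AddCommGroup N] [Module ℂ N]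
    [Module (QAlg q) N] [IsScalarTower ℂ (QAlg q) N] {s : Set ι} {l : ι → ℂ}
    {f : Induced hq j e M →ₗ[ℂ] N}
    (h : ∀ i ∈ s, ∀ k m, f (X q i • single hq j e M k m) = l i • X q i • f (single hq j e M k m)) :
    TwistedLinear q s l f := fun i hi m =>
  LinearMap.congr_fun (hom_ext hq j e (h i hi) :
    f ∘ₗ Module.toModuleEnd ℂ (S := QAlg q) _ (X q i) =
      l i • Module.toModuleEnd ℂ (S := QAlg q) N (X q i) ∘ₗ f) m

theorem X_smul_pow_smul (i j : ι) (k : ℕ) (m : M) :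
    X q i • X q j ^ k • m = (q i j ^ 2) ^ k • X q j ^ k • X q i • m := by
  induction k with
  | zero => simp
  | succ k ih =>
    rw [pow_succ' (X q j), mul_smul, ← mul_smul (X q i), X_mul_X, smul_assoc, mul_smul, ih,
      smul_algebra_smul_comm _ (X q j), pow_succ' (q i j ^ 2), mul_smul,
      mul_smul]

/-- A twisted linear map out of `M[y]` is determined by its restriction to `y^0 M`, and any lift of
that restriction extends by `y^k m ↦ l_j^k w_j^k F m`. The restriction is twisted even if the
original map is not, which is why `RelProjective` quantifies over all scalars `l`. -/
theorem RelProjective.induced {s : Set ι} (hM : RelProjective q s M) (hj : j ∉ s) :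
    RelProjective q (insert j s) (Induced hq j e M) := by
  intro l N N' _ _ _ _ _ _ _ _ g f hg hf
  have hsj : ∀ i ∈ s, i ≠ j := fun i hi h => hj (h ▸ hi)
  have hfs : ∀ k m, f (Induced.single hq j e M k m) =
      l j ^ k • X q j ^ k • f (Induced.single hq j e M 0 m) := fun k m => by
    induction k with
    | zero => simp
    | succ k ih =>
      rw [← Induced.X_smul_single_self, hf j (Set.mem_insert _ _), ih, smul_algebra_smul_comm,
        smul_smul, smul_smul, pow_succ', pow_succ']
  -- On `y^0 m` the generator `w_i` already acts with the factor `q i j ^ (2 * e)`; the new twist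
  -- divides it out.
  obtain ⟨F, hF, hgF⟩ := hM (fun i => ((q i j ^ 2) ^ e)⁻¹ * l i) N N' g
    (f ∘ₗ Induced.single hq j e M 0) hg fun i hi m => by
      have h := hf i (Set.mem_insert_of_mem _ hi) (Induced.single hq j e M 0 m)
      rw [Induced.X_smul_single_of_ne _ _ _ (hsj i hi), zero_add, map_smul, map_smul] at h
      rw [mul_smul, LinearMap.comp_apply, LinearMap.comp_apply, ← h, inv_smul_smul₀]
      exact pow_ne_zero _ (pow_ne_zero _ (hq.ne_zero i j))
  refine ⟨Induced.desc hq j e fun k => l j ^ k • Module.toModuleEnd ℂ (S := QAlg q) N (X q j ^ k)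
    ∘ₗ F, Induced.twistedLinear_of_single _ _ _ ?_, fun m => ?_⟩
  · rintro i (rfl | hi) k m
    · rw [Induced.X_smul_single_self]
      simp only [Induced.desc_single, LinearMap.smul_apply, LinearMap.comp_apply,
        Module.toModuleEnd_apply, DistribSMul.toLinearMap_apply]
      rw [smul_algebra_smul_comm, smul_smul, smul_smul, pow_succ', pow_succ']
    · rw [Induced.X_smul_single_of_ne _ _ _ (hsj i hi)]
      simp only [Induced.desc_single, LinearMap.smul_apply, LinearMap.comp_apply,
        Module.toModuleEnd_apply, DistribSMul.toLinearMap_apply, map_smul]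
      rw [hF i hi, smul_algebra_smul_comm _ (X q i), X_smul_pow_smul,
        smul_algebra_smul_comm _ (X q j ^ k)]
      simp only [smul_smul]
      congr 1
      have := pow_ne_zero e (pow_ne_zero 2 (hq.ne_zero i j))
      rw [pow_add]
      field_simp
  · refine LinearMap.congr_fun (?_ : g.restrictScalars ℂ ∘ₗ _ = f) m
    refine Induced.hom_ext _ _ _ fun k m => ?_
    rw [hfs]
    simp only [LinearMap.comp_apply, Induced.desc_single, LinearMap.smul_apply,
      Module.toModuleEnd_apply, DistribSMul.toLinearMap_apply, map_smul,
      LinearMap.restrictScalars_apply]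
    rw [hgF]
    rfl

variable (M)

/-- The map `y^k m ↦ w_j^k m` from `M[y]` to `M`. -/
def inducedProj : Induced hq j 0 M →ₗ[QAlg q] M where
  __ := Induced.desc hq j 0 fun k => Module.toModuleEnd ℂ (S := QAlg q) M (X q j ^ k)
  map_smul' := TwistedLinear.map_smul' <| Induced.twistedLinear_of_single _ _ _ fun i _ k m => by
    rw [Pi.one_apply, one_smul]
    by_cases hi : i = j
    · subst hi
      rw [Induced.X_smul_single_self]
      simp [pow_succ', mul_smul]
    · rw [Induced.X_smul_single_of_ne _ _ _ hi]
      simp [X_smul_pow_smul]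

/-- The map `y^k m ↦ y^(k+1) m - y^k w_j m` from the twisted `M[y]` to `M[y]`. -/
def inducedRel : Induced hq j 1 M →ₗ[QAlg q] Induced hq j 0 M where
  __ := Induced.desc hq j 1 fun k => Induced.single hq j 0 M (k + 1) -
    Induced.single hq j 0 M k ∘ₗ Module.toModuleEnd ℂ (S := QAlg q) M (X q j)
  map_smul' := TwistedLinear.map_smul' <| Induced.twistedLinear_of_single _ _ _ fun i _ k m => by
    rw [Pi.one_apply, one_smul]
    by_cases hi : i = j
    · subst hi
      rw [Induced.X_smul_single_self]
      simp [smul_sub, Induced.X_smul_single_self]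
    · rw [Induced.X_smul_single_of_ne _ _ _ hi]
      -- Moving `w_i` past `w_j` in the second term yields one more factor `q i j ^ 2`, as does the
      -- extra `y` in the first term; the twist `e = 1` on the source accounts for it.
      have := X_smul_pow_smul (q := q) i j 1 m
      rw [pow_one, pow_one] at this
      simp [smul_sub, Induced.X_smul_single_of_ne _ _ _ hi, this, pow_succ, smul_smul]

variable {M}

theorem inducedProj_single (k : ℕ) (m : M) :
    inducedProj hq j M (Induced.single hq j 0 M k m) = X q j ^ k • m :=
  Induced.desc_single ..

theorem inducedRel_single (k : ℕ) (m : M) :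
    inducedRel hq j M (Induced.single hq j 1 M k m) =
      Induced.single hq j 0 M (k + 1) m - Induced.single hq j 0 M k (X q j • m) :=
  Induced.desc_single ..

/-- If `∑ y^k m_k` is in the kernel, comparing coefficients of `y^(k+1)` gives `m_k = w_j m_(k+1)`,
hence `m_k = w_j^n m_(k+n)`, which vanishes for large `n`. -/
theorem inducedRel_injective : Function.Injective (inducedRel hq j M) := by
  rw [injective_iff_map_eq_zero]
  intro f hf
  have key : ∀ k, Induced.coeff hq j 0 (k + 1) ∘ₗ (inducedRel hq j M).restrictScalars ℂ =
      Induced.coeff hq j 1 k -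
        Module.toModuleEnd ℂ (S := QAlg q) M (X q j) ∘ₗ Induced.coeff hq j 1 (k + 1) :=
    fun k => Induced.hom_ext _ _ _ fun n m => by
      rw [LinearMap.comp_apply, LinearMap.restrictScalars_apply, inducedRel_single]
      simp only [map_sub, LinearMap.sub_apply, LinearMap.comp_apply, Induced.coeff_single,
        Module.toModuleEnd_apply, DistribSMul.toLinearMap_apply, smul_ite, smul_zero,
        Nat.add_right_cancel_iff]
  have h1 : ∀ k, Induced.coeff hq j 1 k f = X q j • Induced.coeff hq j 1 (k + 1) f := fun k => by
    have := LinearMap.congr_fun (key k) f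
    rw [LinearMap.comp_apply, LinearMap.restrictScalars_apply, hf, map_zero] at this
    exact sub_eq_zero.1 this.symm
  have h2 : ∀ n k, Induced.coeff hq j 1 k f = X q j ^ n • Induced.coeff hq j 1 (k + n) f := by
    intro n
    induction n with
    | zero => simp
    | succ n ih => intro k; rw [ih, h1, ← mul_smul, ← pow_succ, add_assoc]
  refine Finsupp.ext fun k => ?_
  obtain ⟨n, hn⟩ := (show ℕ →₀ M from f).support.exists_nat_subset_range
  have h3 : Induced.coeff hq j 1 (k + n) f = 0 :=
    Finsupp.notMem_support_iff.1 fun h => by simpa using hn h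
  exact (h2 n k).trans (by rw [h3, smul_zero]; rfl)

theorem inducedProj_surjective : Function.Surjective (inducedProj hq j M) := fun m =>
  ⟨Induced.single hq j 0 M 0 m, by rw [inducedProj_single, pow_zero, one_smul]⟩

theorem inducedProj_comp_inducedRel (f : Induced hq j 1 M) :
    inducedProj hq j M (inducedRel hq j M f) = 0 :=
  LinearMap.congr_fun (Induced.hom_ext _ _ _ fun k m => by
    simp [inducedRel_single, inducedProj_single, pow_succ, mul_smul] :
    (inducedProj hq j M).restrictScalars ℂ ∘ₗ (inducedRel hq j M).restrictScalars ℂ = 0) f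

/-- Modulo the image of `inducedRel`, `y` may be traded for `w_j`, so every element is congruent to
its projection placed in `y^0 M`. -/
theorem exact_inducedRel_inducedProj :
    Function.Exact (inducedRel hq j M) (inducedProj hq j M) := by
  have key : ∀ f : Induced hq j 0 M, f - Induced.single hq j 0 M 0 (inducedProj hq j M f) ∈
      (inducedRel hq j M).range := by
    intro f
    have h : ∀ k m, Induced.single hq j 0 M k m - Induced.single hq j 0 M 0 (X q j ^ k • m) ∈
        (inducedRel hq j M).range := fun k => by
      induction k with
      | zero => simp
      | succ k ih =>
        intro m
        have := add_mem (LinearMap.mem_range_self (inducedRel hq j M)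
          (Induced.single hq j 1 M k m)) (ih (X q j • m))
        rwa [inducedRel_single, sub_add_sub_cancel, ← mul_smul, ← pow_succ] at this
    induction f using Induced.induction with
    | h0 => rw [map_zero, map_zero, sub_zero]; exact zero_mem _
    | ha f g hf hg =>
      have := add_mem hf hg
      rw [map_add, map_add]
      rwa [← add_sub_add_comm] at this
    | hs k m => rw [inducedProj_single]; exact h k m
  intro f
  constructor
  · intro hf
    have := key f
    rwa [hf, map_zero, sub_zero] at this
  · rintro ⟨g, rfl⟩
    exact inducedProj_comp_inducedRel hq j g

end Induced

/-- Induction on the number `k` of generators outside `s`: both induced modules are projective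
relative to `insert j s`, hence have projective dimension at most `k`, and the cokernel `M` has at
most one more. -/
theorem RelProjective.hasProjectiveDimensionLT [Fintype ι] (hq : IsSkewParam q) (k : ℕ)
    (s : Finset ι) (hs : s.card + k = Fintype.card ι) (M : Type) [AddCommGroup M] [Module ℂ M]
    [Module (QAlg q) M] [IsScalarTower ℂ (QAlg q) M] (hM : RelProjective q (s : Set ι) M) :
    HasProjectiveDimensionLT (ModuleCat.of (QAlg q) M) (k + 1) := by
  classical
  induction k generalizing s M with
  | zero =>
    rw [(Finset.card_eq_iff_eq_univ s).1 hs, Finset.coe_univ] at hM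
    have := hM.projective
    infer_instance
  | succ k ih =>
    obtain ⟨j, hj⟩ : ∃ j, j ∉ s := by
      by_contra! h
      rw [Finset.eq_univ_of_forall h, Finset.card_univ] at hs
      omega
    have h : ∀ e, HasProjectiveDimensionLT (ModuleCat.of (QAlg q) (Induced hq j e M)) (k + 1) :=
      fun e => ih (insert j s) (by rw [Finset.card_insert_of_notMem hj]; omega) _ (by
        rw [Finset.coe_insert]; exact hM.induced hq j e hj)
    have hS := ShortComplex.ShortExact.mk' (S := ShortComplex.mk
      (ModuleCat.ofHom (inducedRel hq j M)) (ModuleCat.ofHom (inducedProj hq j M))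
      (ModuleCat.hom_ext (LinearMap.ext (inducedProj_comp_inducedRel hq j))))
      ((ShortComplex.ShortExact.moduleCat_exact_iff_function_exact _).2
        (exact_inducedRel_inducedProj hq j))
      ((ModuleCat.mono_iff_injective _).2 (inducedRel_injective hq j))
      ((ModuleCat.epi_iff_surjective _).2 (inducedProj_surjective hq j))
    exact hS.hasProjectiveDimensionLT_X₃ (k + 1) (h 1)
      (hasProjectiveDimensionLT_of_ge _ (k + 1) _ (by omega))

theorem hasProjectiveDimensionLE [Fintype ι] (hq : IsSkewParam q) (M : ModuleCat.{0} (QAlg q)) :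
    HasProjectiveDimensionLE M (Fintype.card ι) := by
  let _ : Module ℂ M := Module.compHom M (algebraMap ℂ (QAlg q))
  have : IsScalarTower ℂ (QAlg q) M := .of_algebraMap_smul fun _ _ => rfl
  exact RelProjective.hasProjectiveDimensionLT hq _ ∅ (by simp) M (by
    rw [Finset.coe_empty]; exact relProjective_empty M)

end quantumSpace

/-! ### The groups `Ext^k(A / (w_i : i ∈ s), A)` -/

namespace RightExt

variable {A : Type} [Ring A]

/-- The contravariant functoriality of `Ext^k(-, A)`. -/
def pre {M N : ModuleCat.{0} Aᵐᵒᵖ} (f : M ⟶ N) (k : ℕ) :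
    RightExt A N k →ₗ[A] RightExt A M k where
  toFun e := (Abelian.Ext.mk₀ f).comp (show Abelian.Ext N (ModuleCat.of Aᵐᵒᵖ A) k from e)
    (zero_add k)
  map_add' _ _ := Abelian.Ext.comp_add ..
  map_smul' _ _ := (Abelian.Ext.comp_assoc_of_third_deg_zero ..).symm

theorem pre_comp {M N P : ModuleCat.{0} Aᵐᵒᵖ} (f : M ⟶ N) (g : N ⟶ P) (k : ℕ)
    (e : RightExt A P k) : pre f k (pre g k e) = pre (f ≫ g) k e :=
  Abelian.Ext.mk₀_comp_mk₀_assoc ..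

theorem pre_id {M : ModuleCat.{0} Aᵐᵒᵖ} (k : ℕ) (e : RightExt A M k) : pre (𝟙 M) k e = e :=
  Abelian.Ext.mk₀_id_comp _

/-- `Ext^k(M, A)` only depends on the isomorphism class of `M`. -/
def congr {M N : ModuleCat.{0} Aᵐᵒᵖ} (f : M ≅ N) (k : ℕ) :
    RightExt A N k ≃ₗ[A] RightExt A M k :=
  { pre f.hom k with
    invFun := pre f.inv k
    left_inv := fun e => by
      refine (pre_comp f.inv f.hom k e).trans ?_
      rw [f.inv_hom_id, pre_id]
    right_inv := fun e => by
      refine (pre_comp f.hom f.inv k e).trans ?_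
      rw [f.hom_inv_id, pre_id] }

variable {S : ShortComplex (ModuleCat.{0} Aᵐᵒᵖ)} (hS : S.ShortExact)

/-- The connecting homomorphism of the long exact sequence for `Ext^k(-, A)`. -/
def delta {k l : ℕ} (h : 1 + k = l) : RightExt A S.X₁ k →ₗ[A] RightExt A S.X₃ l where
  toFun e := hS.extClass.comp (show Abelian.Ext S.X₁ (ModuleCat.of Aᵐᵒᵖ A) k from e) h
  map_add' _ _ := Abelian.Ext.comp_add ..
  map_smul' _ _ := (Abelian.Ext.comp_assoc_of_third_deg_zero ..).symm

theorem delta_eq_zero_iff {k l : ℕ} (h : 1 + k = l) (e : RightExt A S.X₁ k) :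
    delta hS h e = 0 ↔ ∃ e', pre S.f k e' = e :=
  ⟨fun he => Abelian.Ext.contravariant_sequence_exact₁ hS _ e h he, by
    rintro ⟨e', rfl⟩; exact hS.extClass_comp_assoc (h := h) e'⟩

theorem exists_delta_eq {k l : ℕ} (h : 1 + k = l) (e : RightExt A S.X₃ l)
    (he : pre S.g l e = 0) : ∃ e', delta hS h e' = e :=
  Abelian.Ext.contravariant_sequence_exact₃ hS _ e he h

include hS in
theorem pre_injective : Function.Injective (pre S.g 0) :=
  haveI := hS.epi_g
  Abelian.Ext.precomp_mk₀_injective_of_epi _ S.g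

theorem pre_pre_eq_zero (S : ShortComplex (ModuleCat.{0} Aᵐᵒᵖ)) {k : ℕ} (e : RightExt A S.X₃ k) :
    pre S.f k (pre S.g k e) = 0 := by
  rw [pre_comp, S.zero]
  change (Abelian.Ext.mk₀ 0).comp _ (zero_add k) = 0
  rw [Abelian.Ext.mk₀_zero, Abelian.Ext.zero_comp]

theorem pre_delta {S' : ShortComplex (ModuleCat.{0} Aᵐᵒᵖ)} (hS' : S'.ShortExact) (f : S ⟶ S')
    {k l : ℕ} (h : 1 + k = l) (e : RightExt A S'.X₁ k) :
    pre f.τ₃ l (delta hS' h e) = delta hS h (pre f.τ₁ k e) := by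
  change (Abelian.Ext.mk₀ f.τ₃).comp (hS'.extClass.comp
    (show Abelian.Ext S'.X₁ (ModuleCat.of Aᵐᵒᵖ A) k from e) h) (zero_add l) = hS.extClass.comp
    ((Abelian.Ext.mk₀ f.τ₁).comp (show Abelian.Ext S'.X₁ (ModuleCat.of Aᵐᵒᵖ A) k from e)
    (zero_add k)) h
  rw [← Abelian.Ext.comp_assoc_of_second_deg_zero, hS.extClass_naturality hS' f,
    Abelian.Ext.comp_assoc _ _ _ (zero_add 1) h (by omega)]

end RightExt

/-! ### Monomial ideals, and Ext along the regular normalizing sequence of generators. -/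

namespace quantumSpace

variable {ι : Type} {q : ι → ι → ℂ} (hq : IsSkewParam q)

theorem repr_mon (t : Multiset ι) : (monBasis hq).repr (mon hq t) = Finsupp.single t 1 := by
  rw [← monBasis_apply, Module.Basis.repr_self]

theorem repr_X_mul_cons (j : ι) (b : QAlg q) (t : Multiset ι) :
    (monBasis hq).repr (X q j * b) (j ::ₘ t) = weight q j t * (monBasis hq).repr b t := by
  refine LinearMap.congr_fun ((monBasis hq).ext fun u => ?_ :
    Finsupp.lapply (j ::ₘ t) ∘ₗ (monBasis hq).repr.toLinearMap ∘ₗ LinearMap.mulLeft ℂ (X q j) =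
      weight q j t • Finsupp.lapply t ∘ₗ (monBasis hq).repr.toLinearMap) b
  by_cases h : u = t <;> simp [X_mul_mon, repr_mon, h]

theorem repr_X_mul_of_notMem {j : ι} (b : QAlg q) {t : Multiset ι} (ht : j ∉ t) :
    (monBasis hq).repr (X q j * b) t = 0 := by
  refine LinearMap.congr_fun ((monBasis hq).ext fun u => ?_ :
    Finsupp.lapply t ∘ₗ (monBasis hq).repr.toLinearMap ∘ₗ LinearMap.mulLeft ℂ (X q j) = 0) b
  have h : j ::ₘ u ≠ t := fun h => ht (h ▸ Multiset.mem_cons_self j u)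
  simp [X_mul_mon, repr_mon, h]

theorem repr_mul_X_cons (j : ι) (b : QAlg q) (t : Multiset ι) :
    (monBasis hq).repr (b * X q j) (j ::ₘ t) = (weight q j t)⁻¹ * (monBasis hq).repr b t := by
  refine LinearMap.congr_fun ((monBasis hq).ext fun u => ?_ :
    Finsupp.lapply (j ::ₘ t) ∘ₗ (monBasis hq).repr.toLinearMap ∘ₗ LinearMap.mulRight ℂ (X q j) =
      (weight q j t)⁻¹ • Finsupp.lapply t ∘ₗ (monBasis hq).repr.toLinearMap) b
  by_cases h : u = t <;> simp [mon_mul_X, repr_mon, h]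

theorem repr_mul_X_of_notMem {j : ι} (b : QAlg q) {t : Multiset ι} (ht : j ∉ t) :
    (monBasis hq).repr (b * X q j) t = 0 := by
  refine LinearMap.congr_fun ((monBasis hq).ext fun u => ?_ :
    Finsupp.lapply t ∘ₗ (monBasis hq).repr.toLinearMap ∘ₗ LinearMap.mulRight ℂ (X q j) = 0) b
  have h : j ::ₘ u ≠ t := fun h => ht (h ▸ Multiset.mem_cons_self j u)
  simp [mon_mul_X, repr_mon, h]

/-- The elements all of whose monomials contain a generator with index in `s`. -/
def monomialSpace (s : Set ι) : Submodule ℂ (QAlg q) where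
  carrier := {b | ∀ t : Multiset ι, (∀ i ∈ s, i ∉ t) → (monBasis hq).repr b t = 0}
  zero_mem' := fun t _ => by simp
  add_mem' := fun ha hb t ht => by rw [map_add, Finsupp.add_apply, ha t ht, hb t ht, add_zero]
  smul_mem' := fun c b hb t ht => by rw [map_smul, Finsupp.smul_apply, hb t ht, smul_zero]

variable {hq}

theorem X_mul_mem_monomialSpace {s : Set ι} {b : QAlg q} (hb : b ∈ monomialSpace hq s) (j : ι) :
    X q j * b ∈ monomialSpace hq s := fun t ht => by
  by_cases h : j ∈ t
  · obtain ⟨u, rfl⟩ := Multiset.exists_cons_of_mem h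
    rw [repr_X_mul_cons, hb u fun i hi hiu => ht i hi (Multiset.mem_cons_of_mem hiu), mul_zero]
  · exact repr_X_mul_of_notMem hq b h

theorem mul_X_mem_monomialSpace {s : Set ι} {b : QAlg q} (hb : b ∈ monomialSpace hq s) (j : ι) :
    b * X q j ∈ monomialSpace hq s := fun t ht => by
  by_cases h : j ∈ t
  · obtain ⟨u, rfl⟩ := Multiset.exists_cons_of_mem h
    rw [repr_mul_X_cons, hb u fun i hi hiu => ht i hi (Multiset.mem_cons_of_mem hiu), mul_zero]
  · exact repr_mul_X_of_notMem hq b h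

theorem mul_mem_monomialSpace_left {s : Set ι} (a : QAlg q) {b : QAlg q}
    (hb : b ∈ monomialSpace hq s) : a * b ∈ monomialSpace hq s := by
  induction a using (quantumSpace q).gen_induction generalizing b with
  | hc c => rw [← Algebra.smul_def]; exact Submodule.smul_mem _ _ hb
  | hg i => exact X_mul_mem_monomialSpace hb i
  | hm a b h₁ h₂ => rw [mul_assoc]; exact h₁ (h₂ hb)
  | ha a b h₁ h₂ => rw [add_mul]; exact add_mem (h₁ hb) (h₂ hb)

theorem mul_mem_monomialSpace_right {s : Set ι} (a : QAlg q) {b : QAlg q}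
    (hb : b ∈ monomialSpace hq s) : b * a ∈ monomialSpace hq s := by
  induction a using (quantumSpace q).gen_induction generalizing b with
  | hc c => rw [← Algebra.commutes, ← Algebra.smul_def]; exact Submodule.smul_mem _ _ hb
  | hg i => exact mul_X_mem_monomialSpace hb i
  | hm a b h₁ h₂ => rw [← mul_assoc]; exact h₂ (h₁ hb)
  | ha a b h₁ h₂ => rw [mul_add]; exact add_mem (h₁ hb) (h₂ hb)

/-- Adding the letter `j ∉ s` to a monomial does not create a letter in `s`: this is regularity of
`w_j` modulo the ideal. -/
theorem mem_of_X_mul_mem {s : Set ι} {j : ι} (hj : j ∉ s) {b : QAlg q}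
    (hb : X q j * b ∈ monomialSpace hq s) : b ∈ monomialSpace hq s := fun t ht => by
  have := hb (j ::ₘ t) fun i hi => by
    rw [Multiset.mem_cons, not_or]
    exact ⟨fun h => hj (h ▸ hi), ht i hi⟩
  rw [repr_X_mul_cons] at this
  exact (mul_eq_zero.1 this).resolve_left (weight_ne_zero hq j t)

theorem mem_of_mul_X_mem {s : Set ι} {j : ι} (hj : j ∉ s) {b : QAlg q}
    (hb : b * X q j ∈ monomialSpace hq s) : b ∈ monomialSpace hq s := fun t ht => by
  have := hb (j ::ₘ t) fun i hi => by
    rw [Multiset.mem_cons, not_or]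
    exact ⟨fun h => hj (h ▸ hi), ht i hi⟩
  rw [repr_mul_X_cons] at this
  exact (mul_eq_zero.1 this).resolve_left (inv_ne_zero (weight_ne_zero hq j t))

theorem monomialSpace_mono {s s' : Set ι} (h : s ⊆ s') :
    monomialSpace hq s ≤ monomialSpace hq s' := fun _ hb t ht => hb t fun i hi => ht i (h hi)

theorem X_mem_monomialSpace {s : Set ι} {j : ι} (hj : j ∈ s) : X q j ∈ monomialSpace hq s :=
  fun t ht => by
    rw [← mul_one (X q j)]
    exact repr_X_mul_of_notMem hq 1 (ht j hj)

theorem monomialSpace_le {s : Set ι} {P : Submodule ℂ (QAlg q)}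
    (h : ∀ t, (∃ i ∈ s, i ∈ t) → mon hq t ∈ P) : monomialSpace hq s ≤ P := fun b hb => by
  rw [← (monBasis hq).linearCombination_repr b, Finsupp.linearCombination_apply]
  refine Submodule.sum_mem _ fun t ht => Submodule.smul_mem _ _ ?_
  rw [monBasis_apply]
  refine h t ?_
  by_contra! hs
  exact Finsupp.mem_support_iff.1 ht (hb t hs)

theorem exists_sub_X_mul_mem {s : Set ι} {j : ι} {b : QAlg q}
    (hb : b ∈ monomialSpace hq (insert j s)) : ∃ c, b - X q j * c ∈ monomialSpace hq s := by
  have h : monomialSpace hq (insert j s) ≤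
      (LinearMap.mulLeft ℂ (X q j)).range ⊔ monomialSpace hq s := by
    refine monomialSpace_le fun t ht => ?_
    by_cases hj : j ∈ t
    · obtain ⟨u, rfl⟩ := Multiset.exists_cons_of_mem hj
      rw [mon_cons]
      exact Submodule.smul_mem _ _ (Submodule.mem_sup_left ⟨mon hq u, rfl⟩)
    · refine Submodule.mem_sup_right fun u hu => ?_
      obtain ⟨i, rfl | hi, hit⟩ := ht
      · exact absurd hit hj
      · exact (congrArg (· u) (repr_mon hq t)).trans
          (Finsupp.single_eq_of_ne fun h : u = t => hu i hi (h ▸ hit))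
  obtain ⟨_, ⟨c, rfl⟩, d, hd, rfl⟩ := Submodule.mem_sup.1 (h hb)
  exact ⟨c, by simpa using hd⟩

theorem exists_sub_mul_X_mem {s : Set ι} {j : ι} {b : QAlg q}
    (hb : b ∈ monomialSpace hq (insert j s)) : ∃ c, b - c * X q j ∈ monomialSpace hq s := by
  have h : monomialSpace hq (insert j s) ≤
      (LinearMap.mulRight ℂ (X q j)).range ⊔ monomialSpace hq s := by
    refine monomialSpace_le fun t ht => ?_
    by_cases hj : j ∈ t
    · obtain ⟨u, rfl⟩ := Multiset.exists_cons_of_mem hj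
      refine Submodule.mem_sup_left ⟨weight q j u • mon hq u, ?_⟩
      rw [LinearMap.mulRight_apply, smul_mul_assoc, mon_mul_X, smul_smul,
        mul_inv_cancel₀ (weight_ne_zero hq j u), one_smul]
    · refine Submodule.mem_sup_right fun u hu => ?_
      obtain ⟨i, rfl | hi, hit⟩ := ht
      · exact absurd hit hj
      · exact (congrArg (· u) (repr_mon hq t)).trans
          (Finsupp.single_eq_of_ne fun h : u = t => hu i hi (h ▸ hit))
  obtain ⟨_, ⟨c, rfl⟩, d, hd, rfl⟩ := Submodule.mem_sup.1 (h hb)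
  exact ⟨c, by simpa using hd⟩

theorem monomialSpace_empty : monomialSpace hq ∅ = ⊥ :=
  eq_bot_iff.2 (monomialSpace_le fun _ ⟨_, h, _⟩ => h.elim)

theorem augmentation_mon_cons (i : ι) (t : Multiset ι) :
    (quantumSpace q).augmentation (mon hq (i ::ₘ t)) = 0 := by
  rw [mon_cons, map_smul, map_mul, QuadraticData.augmentation_gen, zero_mul, smul_zero]

theorem repr_zero (b : QAlg q) :
    (monBasis hq).repr b 0 = (quantumSpace q).augmentation b := by
  refine LinearMap.congr_fun ((monBasis hq).ext fun u => ?_ :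
    Finsupp.lapply 0 ∘ₗ (monBasis hq).repr.toLinearMap =
      (quantumSpace q).augmentation.toLinearMap) b
  induction u using Multiset.induction with
  | empty =>
    have := repr_mon hq 0
    rw [mon_zero] at this
    simp [this]
  | cons i t _ => simp [repr_mon, augmentation_mon_cons]

theorem mem_monomialSpace_univ {b : QAlg q} :
    b ∈ monomialSpace hq Set.univ ↔ (quantumSpace q).augmentation b = 0 := by
  rw [← repr_zero (hq := hq)]
  refine ⟨fun h => h 0 (by simp), fun h t ht => ?_⟩
  rw [Multiset.eq_zero_of_forall_notMem fun i => ht i trivial, h]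

variable (hq)

/-- The right ideal generated by the generators with index in `s`. -/
def rightIdeal (s : Set ι) : Submodule (QAlg q)ᵐᵒᵖ (QAlg q) :=
  { monomialSpace hq s with smul_mem' := fun a _ hb => mul_mem_monomialSpace_right a.unop hb }

/-- The right module `A / (w_i : i ∈ s)`. -/
abbrev Quo (s : Set ι) : ModuleCat.{0} (QAlg q)ᵐᵒᵖ :=
  ModuleCat.of (QAlg q)ᵐᵒᵖ (QAlg q ⧸ rightIdeal hq s)

/-- Left multiplication on `A / (w_i : i ∈ s)`. -/
def quoMul (s : Set ι) (a : QAlg q) : Quo hq s ⟶ Quo hq s :=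
  ModuleCat.ofHom <| Submodule.mapQ _ _ (leftMul _ a) fun _ hb => mul_mem_monomialSpace_left a hb

/-- The projection from `A / (w_i : i ∈ s)` to `A / (w_i : i ∈ s')` for `s ⊆ s'`. -/
def quoProj {s s' : Set ι} (h : s ⊆ s') : Quo hq s ⟶ Quo hq s' :=
  ModuleCat.ofHom <| Submodule.mapQ _ _ LinearMap.id fun _ hb => monomialSpace_mono h hb

/-- The sequence `0 → A / (w_i : i ∈ s) → A / (w_i : i ∈ s) → A / (w_i : i ∈ s ∪ {j}) → 0` given by
left multiplication by `w_j`. -/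
def quoSeq (s : Set ι) (j : ι) : ShortComplex (ModuleCat.{0} (QAlg q)ᵐᵒᵖ) where
  X₁ := Quo hq s
  X₂ := Quo hq s
  X₃ := Quo hq (insert j s)
  f := quoMul hq s (X q j)
  g := quoProj hq (Set.subset_insert j s)
  zero := by
    refine ModuleCat.hom_ext (Submodule.linearMap_qext _ (LinearMap.ext fun b => ?_))
    exact (Submodule.Quotient.mk_eq_zero _).2
      (mul_mem_monomialSpace_right b (X_mem_monomialSpace (Set.mem_insert j s)))

theorem quoSeq_shortExact {s : Set ι} {j : ι} (hj : j ∉ s) : (quoSeq hq s j).ShortExact := by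
  refine ShortComplex.ShortExact.mk' ?_ ?_ ?_
  · rw [ShortComplex.moduleCat_exact_iff]
    intro b hb
    obtain ⟨b, rfl⟩ := Submodule.Quotient.mk_surjective _ b
    obtain ⟨c, hc⟩ := exists_sub_X_mul_mem (hq := hq) (j := j) (s := s)
      ((Submodule.Quotient.mk_eq_zero (rightIdeal hq (insert j s))).1 hb)
    exact ⟨Submodule.Quotient.mk c, ((Submodule.Quotient.eq (rightIdeal hq s)).2 hc).symm⟩
  · refine (ModuleCat.mono_iff_injective _).2 ((injective_iff_map_eq_zero _).2 fun b hb => ?_)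
    obtain ⟨b, rfl⟩ := Submodule.Quotient.mk_surjective _ b
    exact (Submodule.Quotient.mk_eq_zero _).2
      (mem_of_X_mul_mem hj ((Submodule.Quotient.mk_eq_zero (rightIdeal hq s)).1 hb))
  · refine (ModuleCat.epi_iff_surjective _).2 fun b => ?_
    obtain ⟨b, rfl⟩ := Submodule.Quotient.mk_surjective _ b
    exact ⟨Submodule.Quotient.mk b, rfl⟩

/-- Left multiplications act on the sequence `quoSeq`. -/
def quoSeqMul (s : Set ι) (i j : ι) (d : ℂ) : quoSeq hq s j ⟶ quoSeq hq s j where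
  τ₁ := quoMul hq s ((q i j ^ 2 * d) • X q i)
  τ₂ := quoMul hq s (d • X q i)
  τ₃ := quoMul hq (insert j s) (d • X q i)
  comm₁₂ := by
    refine ModuleCat.hom_ext (Submodule.linearMap_qext _ (LinearMap.ext fun b => ?_))
    refine congrArg (Submodule.Quotient.mk (p := rightIdeal hq s)) ?_
    change X q j * (((q i j ^ 2 * d) • X q i) * b) = (d • X q i) * (X q j * b)
    rw [← mul_assoc, ← mul_assoc, mul_smul_comm, smul_mul_assoc d, X_mul_X q i j, smul_smul,
      mul_comm d]
  comm₂₃ := by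
    refine ModuleCat.hom_ext (Submodule.linearMap_qext _ (LinearMap.ext fun b => ?_))
    rfl

/-- `Ext(A / (w_i : i ∈ s), A)` is concentrated in degree `n`, where it is the quotient of `A` by
the generators with index in `s`, on which the endomorphism induced by left multiplication by `w_j`
is a nonzero multiple of right multiplication by `w_j`. -/
structure ExtConcentrated (s : Set ι) (n : ℕ) : Prop where
  ext_eq_zero : ∀ k, k ≠ n → Subsingleton (RightExt (QAlg q) (Quo hq s) k)
  ext_top : ∃ π : QAlg q →ₗ[QAlg q] RightExt (QAlg q) (Quo hq s) n, Function.Surjective π ∧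
    (∀ b, π b = 0 ↔ b ∈ monomialSpace hq s) ∧
    ∀ j ∉ s, ∀ d : ℂ, d ≠ 0 → ∃ c : ℂ, c ≠ 0 ∧
      ∀ b, RightExt.pre (quoMul hq s (d • X q j)) n (π b) = π (c • (b * X q j))

/-- The free right module of rank one. -/
def _root_.MulOpposite.rightRegularEquiv (A : Type*) [Ring A] : Aᵐᵒᵖ ≃ₗ[Aᵐᵒᵖ] A :=
  { opAddEquiv.symm with map_smul' := fun _ _ => rfl }

/-- The homomorphism from `A / 0` to `A` given by left multiplication by `b`. -/
def quoEmptyHom (b : QAlg q) : Quo hq ∅ ⟶ ModuleCat.of (QAlg q)ᵐᵒᵖ (QAlg q) :=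
  ModuleCat.ofHom <| (rightIdeal hq ∅).liftQ (leftMul _ b) fun x hx => by
    have : x ∈ monomialSpace hq ∅ := hx
    rw [monomialSpace_empty] at this
    rw [(Submodule.mem_bot ℂ).1 this]
    exact zero_mem _

theorem quoEmptyHom_mk (b x : QAlg q) :
    (quoEmptyHom hq b).hom (Submodule.Quotient.mk x) = b * x := rfl

theorem rightIdeal_empty : rightIdeal hq ∅ = ⊥ :=
  eq_bot_iff.2 fun x hx => by
    have : x ∈ monomialSpace hq ∅ := hx
    rwa [monomialSpace_empty] at this

/-- The module is free of rank one, so higher Ext vanishes and an endomorphism is left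
multiplication by its value at `1`. Precomposing with left multiplication by `b` turns `a` into `a *
b`, a right multiplication. -/
theorem extConcentrated_empty : ExtConcentrated hq ∅ 0 := by
  have hadd : ∀ a b, quoEmptyHom hq (a + b) = quoEmptyHom hq a + quoEmptyHom hq b := fun a b =>
    ModuleCat.hom_ext (Submodule.linearMap_qext _ (LinearMap.ext fun x => add_mul a b x))
  have hmul : ∀ a b, quoEmptyHom hq (a * b) =
      quoEmptyHom hq b ≫ ModuleCat.ofHom (leftMul (QAlg q) a) := fun a b =>
    ModuleCat.hom_ext (Submodule.linearMap_qext _ (LinearMap.ext fun x => mul_assoc a b x))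
  have hpre : ∀ a b, quoEmptyHom hq (a * b) = quoMul hq ∅ b ≫ quoEmptyHom hq a := fun a b =>
    ModuleCat.hom_ext (Submodule.linearMap_qext _ (LinearMap.ext fun x => mul_assoc a b x))
  refine ⟨fun k hk => ?_, ⟨⟨fun b => Abelian.Ext.mk₀ (quoEmptyHom hq b), fun a b => ?_⟩,
    fun a b => ?_⟩, fun e => ?_, fun b => ?_, fun j _ d hd => ⟨d, hd, fun b => ?_⟩⟩
  · obtain ⟨k, rfl⟩ := Nat.exists_eq_succ_of_ne_zero hk
    have : Module.Free (QAlg q)ᵐᵒᵖ (QAlg q ⧸ rightIdeal hq ∅) :=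
      .of_equiv ((rightRegularEquiv (QAlg q)).trans
        (Submodule.quotEquivOfEqBot _ (rightIdeal_empty hq)).symm)
    have : Projective (Quo hq ∅) := ModuleCat.projective_of_free (Module.Free.chooseBasis _ _)
    exact subsingleton_of_forall_eq 0 fun e => Abelian.Ext.eq_zero_of_projective e
  · rw [hadd]; exact Abelian.Ext.mk₀_add ..
  · exact (congrArg Abelian.Ext.mk₀ (hmul a b)).trans (Abelian.Ext.mk₀_comp_mk₀ ..).symm
  · obtain ⟨f, rfl⟩ := Abelian.Ext.homEquiv₀.symm.surjective e
    refine ⟨f.hom (Submodule.Quotient.mk 1), congrArg Abelian.Ext.mk₀ ?_⟩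
    refine ModuleCat.hom_ext (Submodule.linearMap_qext _ (LinearMap.ext fun x => ?_))
    refine (f.hom.map_smul (op x) (Submodule.Quotient.mk 1)).symm.trans ?_
    rw [← Submodule.Quotient.mk_smul, op_smul_eq_mul, one_mul]
    rfl
  · rw [monomialSpace_empty, Submodule.mem_bot]
    refine ⟨fun h => ?_, ?_⟩
    · have h' := Abelian.Ext.homEquiv₀.symm.injective (a₁ := quoEmptyHom hq b) (a₂ := 0)
        (h.trans (Abelian.Ext.mk₀_zero _ _).symm)
      rw [← mul_one b, ← quoEmptyHom_mk hq, h']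
      rfl
    · rintro rfl
      have h0 : quoEmptyHom hq 0 = 0 :=
        ModuleCat.hom_ext (Submodule.linearMap_qext _ (LinearMap.ext fun x => zero_mul x))
      exact (congrArg Abelian.Ext.mk₀ h0).trans (Abelian.Ext.mk₀_zero _ _)
  · refine (Abelian.Ext.mk₀_comp_mk₀ ..).trans (congrArg Abelian.Ext.mk₀ ?_)
    rw [← mul_smul_comm, hpre]

variable {hq}

/-- In the long exact sequence of `quoSeq`, the map induced by `w_j` on `Ext^n` is, up to a nonzero
scalar, right multiplication by `w_j` on `A / (w_i : i ∈ s)`. It is injective, which kills `Ext^n`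
of the quotient, and its cokernel is `Ext^(n+1)`. -/
theorem ExtConcentrated.insert {s : Set ι} {n : ℕ} (hs : ExtConcentrated hq s n) {j : ι}
    (hj : j ∉ s) : ExtConcentrated hq (insert j s) (n + 1) := by
  obtain ⟨h₀, π, hπ, hker, hmul⟩ := hs
  have hS := quoSeq_shortExact hq hj
  obtain ⟨c, hc, hcX⟩ := hmul j hj 1 one_ne_zero
  rw [one_smul] at hcX
  let δ (k : ℕ) : RightExt (QAlg q) (Quo hq s) k →ₗ[QAlg q]
    RightExt (QAlg q) (Quo hq (Insert.insert j s)) (k + 1) := RightExt.delta hS (add_comm 1 k)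
  have hδ₀ (e) : δ n e = 0 ↔ ∃ e', RightExt.pre (quoMul hq s (X q j)) n e' = e :=
    RightExt.delta_eq_zero_iff hS _ e
  have hδ₁ (k e) (he : RightExt.pre (quoProj hq (Set.subset_insert j s)) (k + 1) e = 0) :
    ∃ e', δ k e' = e := RightExt.exists_delta_eq hS (add_comm 1 k) e he
  have hpre (e) : RightExt.pre (quoProj hq (Set.subset_insert j s)) n e = 0 := by
    obtain ⟨b, hb⟩ := hπ (RightExt.pre (quoProj hq (Set.subset_insert j s)) n e)
    have h : RightExt.pre (quoMul hq s (X q j)) n (π b) = 0 :=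
      hb ▸ RightExt.pre_pre_eq_zero (quoSeq hq s j) e
    rw [hcX, hker, Submodule.smul_mem_iff _ hc] at h
    rw [← hb, hker]
    exact mem_of_mul_X_mem hj h
  refine ⟨fun k hk => subsingleton_of_forall_eq 0 fun e => ?_, δ n ∘ₗ π, fun e => ?_, fun b => ?_,
    fun i hi d hd => ?_⟩
  · have he : RightExt.pre (quoProj hq (Set.subset_insert j s)) k e = 0 := by
      by_cases hkn : k = n
      · subst hkn
        exact hpre e
      · exact (h₀ k hkn).elim _ _
    cases k with
    -- No connecting map ends in degree zero; left exactness of `Hom(-, A)` replaces it.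
    | zero => exact RightExt.pre_injective hS (he.trans (map_zero _).symm)
    | succ k =>
      obtain ⟨e', rfl⟩ := hδ₁ k e he
      rw [(h₀ k (by omega)).elim e' 0, map_zero]
  · obtain ⟨e', he'⟩ := hδ₁ n e ((h₀ (n + 1) (by omega)).elim _ _)
    obtain ⟨b, rfl⟩ := hπ e'
    exact ⟨b, he'⟩
  · rw [LinearMap.comp_apply, hδ₀]
    constructor
    · rintro ⟨e', he'⟩
      obtain ⟨b', rfl⟩ := hπ e'
      have h := (hker (b - c • (b' * X q j))).1 (by rw [map_sub, ← hcX, he', sub_self])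
      have h' := mul_mem_monomialSpace_left b' (X_mem_monomialSpace (hq := hq) (Set.mem_insert j s))
      have := add_mem (monomialSpace_mono (Set.subset_insert j s) h) (Submodule.smul_mem _ c h')
      rwa [sub_add_cancel] at this
    · intro hb
      obtain ⟨b', hb'⟩ := exists_sub_mul_X_mem hb
      refine ⟨π (c⁻¹ • b'), (hcX _).trans ?_⟩
      rw [smul_mul_assoc, smul_smul, mul_inv_cancel₀ hc, one_smul, eq_comm, ← sub_eq_zero,
        ← map_sub]
      exact (hker _).2 hb'
  · rw [Set.mem_insert_iff, not_or] at hi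
    -- Commuting `w_i` past `w_j` rescales the induced endomorphism of the first term of `quoSeq`;
    -- the arbitrary scalar `d` in the induction hypothesis absorbs this.
    obtain ⟨c', hc', h⟩ := hmul i hi.2 (q i j ^ 2 * d)
      (mul_ne_zero (pow_ne_zero _ (hq.ne_zero i j)) hd)
    refine ⟨c', hc', fun b => ?_⟩
    rw [LinearMap.comp_apply, LinearMap.comp_apply, ← h]
    exact RightExt.pre_delta hS hS (quoSeqMul hq s i j d) (add_comm 1 n) (π b)

variable (hq)

theorem extConcentrated_coe (s : Finset ι) : ExtConcentrated hq (s : Set ι) s.card := by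
  classical
  induction s using Finset.induction with
  | empty => rw [Finset.coe_empty]; exact extConcentrated_empty hq
  | insert j s hj ih =>
    rw [Finset.coe_insert, Finset.card_insert_of_notMem hj]
    exact ih.insert hj

/-- The quotient of `A` by all generators is the trivial module. -/
def quoUnivEquiv : (QAlg q ⧸ rightIdeal hq Set.univ) ≃ₗ[(QAlg q)ᵐᵒᵖ]
    TrivialModule (quantumSpace q).augmentation :=
  (Submodule.quotEquivOfEq _ _ (Submodule.ext fun _ => mem_monomialSpace_univ)).trans
    ((TrivialModule.aug (quantumSpace q).augmentation).quotKerEquivOfSurjective fun c =>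
      ⟨algebraMap ℂ _ c, (quantumSpace q).augmentation.commutes c⟩)

/-- The augmentation, as a homomorphism of left modules from `A` to the trivial module. -/
def _root_.TrivialModule.leftAug {A : Type} [Ring A] [Algebra ℂ A] (ε : A →ₐ[ℂ] ℂ) :
    A →ₗ[A] TrivialModule ε where
  toFun a := ε a
  map_add' := map_add ε
  map_smul' := map_mul ε

theorem isGorensteinAlgebra (hq : IsSkewParam q) [Fintype ι] :
    IsGorensteinAlgebra (quantumSpace q).augmentation (Fintype.card ι) := by
  have h := extConcentrated_coe hq Finset.univ
  rw [Finset.coe_univ, Finset.card_univ] at h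
  have e : ModuleCat.of (QAlg q)ᵐᵒᵖ (TrivialModule (quantumSpace q).augmentation) ≅
    Quo hq Set.univ := (quoUnivEquiv hq).symm.toModuleIso
  obtain ⟨h₀, π, hπ, hker, -⟩ := h
  refine ⟨fun k hk => ?_, ⟨?_⟩⟩
  · have := h₀ k hk
    exact (RightExt.congr e k).symm.toEquiv.subsingleton
  · have hk : π.ker = (TrivialModule.leftAug (quantumSpace q).augmentation).ker := by
      ext b
      exact (hker b).trans mem_monomialSpace_univ
    let e₁ := (RightExt.congr e (Fintype.card ι)).symm
    let e₂ := (π.quotKerEquivOfSurjective hπ).symm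
    let e₃ := (TrivialModule.leftAug (quantumSpace q).augmentation).quotKerEquivOfSurjective
      fun c => ⟨algebraMap ℂ _ c, (quantumSpace q).augmentation.commutes c⟩
    exact e₁.trans (e₂.trans ((Submodule.quotEquivOfEq _ _ hk).trans e₃))

end quantumSpace

/-! ### The global dimensions -/

attribute [local instance] RingHomInvPair.of_ringEquiv in
theorem globalDimension_le_of_ringEquiv {R S : Type} [Ring R] [Ring S] (e : R ≃+* S) :
    globalDimension R ≤ globalDimension S := by
  refine iSup_le fun M => ?_
  have h : projectiveDimension M =
      projectiveDimension ((ModuleCat.restrictScalars e.symm.toRingHom).obj M) :=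
    ModuleCat.projectiveDimension_eq_of_semiLinearEquiv e
      { AddEquiv.refl M with
        map_smul' := fun r m => by
          change r • m = e.symm (e r) • m
          rw [e.symm_apply_apply] }
  rw [h]
  exact le_iSup (fun N : ModuleCat.{0} S => projectiveDimension N) _

namespace quantumSpace

variable {ι : Type} {q : ι → ι → ℂ}

/-- The homomorphism fixing the generators from a quantum affine space to the opposite algebra of
the quantum affine space with transposed parameters. -/
def toOpposite (q : ι → ι → ℂ) : QAlg q →ₐ[ℂ] (QAlg fun i j => q j i)ᵐᵒᵖ :=
  qlift (fun i => op (X (fun i j => q j i) i)) fun i j => by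
    rw [← op_mul, ← op_mul, ← op_smul, X_mul_X _ j i]

theorem toOpposite_X (q : ι → ι → ℂ) (i : ι) :
    toOpposite q (X q i) = op (X (fun i j => q j i) i) := qlift_X ..

theorem toOpposite_unop_toOpposite (q : ι → ι → ℂ) (b : QAlg q) :
    toOpposite (fun i j => q j i) (unop (toOpposite q b)) = op b := by
  induction b using (quantumSpace q).gen_induction with
  | hc c => rw [AlgHom.commutes, MulOpposite.algebraMap_apply, unop_op, AlgHom.commutes, MulOpposite.algebraMap_apply]
  | hg i => rw [toOpposite_X, unop_op, toOpposite_X]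
  | hm a b h₁ h₂ => rw [map_mul, unop_mul, map_mul, h₁, h₂, op_mul]
  | ha a b h₁ h₂ => rw [map_add, MulOpposite.unop_add, map_add, h₁, h₂, MulOpposite.op_add]

/-- The opposite algebra of a quantum affine space is the quantum affine space with transposed
parameters. -/
def opEquiv (q : ι → ι → ℂ) : (QAlg q)ᵐᵒᵖ ≃ₐ[ℂ] QAlg fun i j => q j i :=
  AlgEquiv.ofAlgHom (AlgHom.opComm (toOpposite q)) (toOpposite fun i j => q j i)
    (AlgHom.ext fun b => congrArg unop (toOpposite_unop_toOpposite _ b))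
    (AlgHom.ext fun b => toOpposite_unop_toOpposite q b.unop)

theorem globalDimension_le (hq : IsSkewParam q) [Fintype ι] :
    globalDimension (QAlg q) ≤ (Fintype.card ι : ℕ∞) :=
  iSup_le fun M => (projectiveDimension_le_iff M _).2 (hasProjectiveDimensionLE hq M)

/-- A smaller projective dimension of the trivial module would force its top Ext group into `A` to
vanish, but this group is `ℂ`. -/
theorem le_globalDimension_op (hq : IsSkewParam q) [Fintype ι] :
    ((Fintype.card ι : ℕ∞) : WithBot ℕ∞) ≤ globalDimension (QAlg q)ᵐᵒᵖ := by
  refine le_iSup_of_le (ModuleCat.of (QAlg q)ᵐᵒᵖ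
    (TrivialModule (quantumSpace q).augmentation)) ((projectiveDimension_ge_iff _ _).2 fun h => ?_)
  obtain ⟨e⟩ := (isGorensteinAlgebra hq).ext_top
  have h₁ : Subsingleton (RightExt (QAlg q) _ (Fintype.card ι)) := h.subsingleton _ _ (Fintype.card ι) le_rfl (ModuleCat.of (QAlg q)ᵐᵒᵖ (QAlg q))
  have h₂ : Subsingleton ℂ := (e.symm.toEquiv : ℂ ≃ _).subsingleton
  exact one_ne_zero (h₂.elim (1 : ℂ) 0)

theorem globalDimension_op (hq : IsSkewParam q) [Fintype ι] :
    globalDimension (QAlg q)ᵐᵒᵖ = (Fintype.card ι : ℕ∞) :=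
  ((globalDimension_le_of_ringEquiv (opEquiv q).toRingEquiv).trans
    (globalDimension_le hq.swap)).antisymm (le_globalDimension_op hq)

theorem globalDimension_eq (hq : IsSkewParam q) [Fintype ι] :
    globalDimension (QAlg q) = (Fintype.card ι : ℕ∞) :=
  (globalDimension_le hq).antisymm ((le_globalDimension_op hq.swap).trans
    (globalDimension_le_of_ringEquiv (opEquiv fun i j => q j i).toRingEquiv))

theorem isRegularAlgebra (hq : IsSkewParam q) [Fintype ι] :
    IsRegularAlgebra (quantumSpace q).augmentation (Fintype.card ι) :=
  ⟨globalDimension_op hq, globalDimension_eq hq, isGorensteinAlgebra hq⟩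

end quantumSpace

/-! ### The Koszul spaces of a quantum affine space -/

theorem ι_mem_freeGen {ι : Type} (i : ι) : FreeAlgebra.ι ℂ i ∈ freeGen ι :=
  Submodule.subset_span ⟨i, rfl⟩

/-! ### Contractions of the last letter and the quadratic relations. -/

section DropLast

variable {ι : Type} [DecidableEq ι]

theorem sum_dropLast_mul [Fintype ι] {P : Submodule ℂ (FreeAlgebra ℂ ι)} {x : FreeAlgebra ℂ ι}
    (hx : x ∈ P * freeGen ι) : ∑ i, dropLast i x * FreeAlgebra.ι ℂ i = x := by
  induction hx using Submodule.mul_induction_on' with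
  | mem_mul_mem a ha b hb =>
    induction hb using Submodule.span_induction with
    | mem x h =>
      obtain ⟨j, rfl⟩ := h
      simp [QuadraticData.dropLast_mul_gen]
    | zero => simp
    | add x y _ _ hx hy =>
      simp only [mul_add, map_add, add_mul, Finset.sum_add_distrib, hx, hy]
    | smul c x _ hx =>
      simp only [mul_smul_comm, map_smul, smul_mul_assoc, ← Finset.smul_sum, hx]
  | add x hx y hy h₁ h₂ => simp only [map_add, add_mul, Finset.sum_add_distrib, h₁, h₂]

theorem sum_dropLast_mul_of_mem_pow [Fintype ι] {k : ℕ} {x : FreeAlgebra ℂ ι}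
    (hx : x ∈ freeGen ι ^ (k + 1)) : ∑ i, dropLast i x * FreeAlgebra.ι ℂ i = x := by
  rw [pow_succ] at hx
  exact sum_dropLast_mul hx

theorem dropLast_mem_pow {k : ℕ} (i : ι) {x : FreeAlgebra ℂ ι}
    (hx : x ∈ freeGen ι ^ (k + 1)) : dropLast i x ∈ freeGen ι ^ k :=
  QuadraticData.dropLast_mem i (by rwa [← pow_succ])

/-- Conditions with a trailing factor `V` can be tested on the coefficients `∂ᵢ x` of `x = ∑ ∂ᵢ x ⊗
w_i`; only the condition with `R` in last position is new. This makes induction on `k` possible. -/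
theorem QuadraticData.mem_koszulSpace_succ [Fintype ι] (Q : QuadraticData ι) {k : ℕ}
    {x : FreeAlgebra ℂ ι} : x ∈ Q.koszulSpace (k + 1) ↔ x ∈ freeGen ι ^ (k + 1) ∧
      (∀ i, dropLast i x ∈ Q.koszulSpace k) ∧ ∀ m, m + 1 = k → x ∈ freeGen ι ^ m * Q.R := by
  refine ⟨fun h => ⟨h.1, fun i => Q.dropLast_mem_koszulSpace i k h, fun m hm => ?_⟩, ?_⟩
  · have := (Submodule.mem_iInf _).1 ((Submodule.mem_iInf _).1 h.2 (m, 0)) (by simp only; omega)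
    rwa [pow_zero, mul_one] at this
  · rintro ⟨h₁, h₂, h₃⟩
    refine ⟨h₁, Submodule.mem_iInf _ |>.2 fun p => Submodule.mem_iInf _ |>.2 fun hp => ?_⟩
    obtain ⟨a, b⟩ := p
    cases b with
    | zero => rw [pow_zero, mul_one]; exact h₃ a (by simp only at hp; omega)
    | succ b =>
      rw [← sum_dropLast_mul_of_mem_pow h₁, pow_succ, ← mul_assoc]
      refine Submodule.sum_mem _ fun i _ => Submodule.mul_mem_mul ?_ (ι_mem_freeGen i)
      exact (Submodule.mem_iInf _).1 ((Submodule.mem_iInf _).1 (h₂ i).2 (a, b))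
        (by simp only at hp ⊢; omega)

variable {q : ι → ι → ℂ}

theorem dropLast_dropLast_of_mem (hq : IsSkewParam q) {m : ℕ} {x : FreeAlgebra ℂ ι}
    (hx : x ∈ freeGen ι ^ m * (quantumSpace q).R) (i j : ι) :
    dropLast j (dropLast i x) = -q i j ^ 2 • dropLast i (dropLast j x) := by
  induction hx using Submodule.mul_induction_on' with
  | mem_mul_mem a ha b hb =>
    induction hb using Submodule.span_induction with
    | mem x h =>
      obtain ⟨⟨k, l⟩, rfl⟩ := h
      simp only [mul_sub, mul_smul_comm, map_sub, map_smul, ← mul_assoc, QuadraticData.dropLast_mul_gen]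
      have h : q i j ^ 2 * q j i ^ 2 = 1 := by rw [← mul_pow, hq.mul_swap, one_pow]
      by_cases h₁ : l = i <;> by_cases h₂ : k = j <;> by_cases h₃ : k = i <;>
        by_cases h₄ : l = j <;> (try subst h₁) <;> (try subst h₂) <;> (try subst h₃) <;>
        (try subst h₄) <;> simp_all [QuadraticData.dropLast_mul_gen, hq.diag, smul_smul]
    | zero => simp
    | add x y _ _ hx hy => simp only [mul_add, map_add, smul_add, hx, hy]
    | smul c x _ hx => simp only [mul_smul_comm, map_smul, hx, smul_comm c]
  | add x hx y hy h₁ h₂ => simp only [map_add, smul_add, h₁, h₂]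

/-- Converse of `dropLast_dropLast_of_mem`. Expanding `x` in its last two letters and averaging with
the swapped expansion exhibits `2x` as a combination of the relations. -/
theorem mem_pow_mul_R [Fintype ι] {m : ℕ} {x : FreeAlgebra ℂ ι}
    (hx : x ∈ freeGen ι ^ (m + 2))
    (h : ∀ i j, dropLast j (dropLast i x) = -q i j ^ 2 • dropLast i (dropLast j x)) :
    x ∈ freeGen ι ^ m * (quantumSpace q).R := by
  have h₁ : x = ∑ i, ∑ j, dropLast j (dropLast i x) * FreeAlgebra.ι ℂ j * FreeAlgebra.ι ℂ i := by
    conv_lhs => rw [← sum_dropLast_mul_of_mem_pow hx]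
    refine Finset.sum_congr rfl fun i _ => ?_
    rw [← Finset.sum_mul, sum_dropLast_mul_of_mem_pow (dropLast_mem_pow i hx)]
  have h₂ : x + x = ∑ i, ∑ j, dropLast i (dropLast j x) *
      (FreeAlgebra.ι ℂ i * FreeAlgebra.ι ℂ j -
        q i j ^ 2 • (FreeAlgebra.ι ℂ j * FreeAlgebra.ι ℂ i)) := by
    conv_lhs =>
      congr
      · rw [h₁, Finset.sum_comm]
      · rw [h₁]
    rw [← Finset.sum_add_distrib]
    refine Finset.sum_congr rfl fun i _ => ?_
    rw [← Finset.sum_add_distrib]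
    refine Finset.sum_congr rfl fun j _ => ?_
    rw [h i j]
    simp only [mul_sub, mul_smul_comm, smul_mul_assoc, neg_smul, ← mul_assoc, neg_mul]
    abel
  have h₃ : x + x ∈ freeGen ι ^ m * (quantumSpace q).R := by
    rw [h₂]
    exact Submodule.sum_mem _ fun i _ => Submodule.sum_mem _ fun j _ => Submodule.mul_mem_mul
      (dropLast_mem_pow i (dropLast_mem_pow j hx)) (Submodule.subset_span ⟨(i, j), rfl⟩)
  rwa [← two_smul ℂ x, Submodule.smul_mem_iff _ two_ne_zero] at h₃

theorem dropLast_dropLast_of_mem_koszulSpace [Fintype ι] (hq : IsSkewParam q) {k : ℕ}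
    {x : FreeAlgebra ℂ ι} (hx : x ∈ (quantumSpace q).koszulSpace (k + 2)) (i j : ι) :
    dropLast j (dropLast i x) = -q i j ^ 2 • dropLast i (dropLast j x) :=
  dropLast_dropLast_of_mem hq (((quantumSpace q).mem_koszulSpace_succ.1 hx).2.2 k rfl) i j

end DropLast

namespace quantumSpace

/-! ### Twisted antisymmetric tensors as a basis of the Koszul spaces. -/

section Sign

variable {ι : Type} [LinearOrder ι] {q : ι → ι → ℂ}

/-- The parameters `q_{ij}`, with a sign for `i < j`. -/
def signParam (q : ι → ι → ℂ) (i j : ι) : ℂ := if i < j then -q i j else q i j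

theorem signParam_sq (i j : ι) : signParam q i j ^ 2 = q i j ^ 2 := by
  unfold signParam; split_ifs <;> ring

theorem signParam_mul_swap (hq : IsSkewParam q) {i j : ι} (h : i ≠ j) :
    signParam q i j * signParam q j i = -1 := by
  have := hq.mul_swap i j
  unfold signParam
  rcases lt_or_gt_of_ne h with h | h
  · rw [if_pos h, if_neg h.not_gt, neg_mul, this]
  · rw [if_pos h, if_neg h.not_gt, mul_neg, this]

theorem signParam_self (hq : IsSkewParam q) (i : ι) : signParam q i i = 1 := by
  rw [signParam, if_neg (lt_irrefl i), hq.diag]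

/-- The coefficient of the contraction of the basis vector with index `S` with `i`. -/
def signWeight (q : ι → ι → ℂ) (i : ι) (S : Finset ι) : ℂ := ∏ j ∈ S, signParam q i j

theorem signWeight_insert (i : ι) {j : ι} {S : Finset ι} (h : j ∉ S) :
    signWeight q i (insert j S) = signParam q i j * signWeight q i S := Finset.prod_insert h

theorem signWeight_erase (i : ι) {j : ι} {S : Finset ι} (h : j ∈ S) :
    signWeight q i S = signParam q i j * signWeight q i (S.erase j) :=
  (Finset.mul_prod_erase S _ h).symm

theorem signParam_ne_zero (hq : IsSkewParam q) (i j : ι) : signParam q i j ≠ 0 := by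
  have := hq.ne_zero i j
  unfold signParam
  split_ifs
  exacts [neg_ne_zero.2 this, this]

theorem signWeight_ne_zero (hq : IsSkewParam q) (i : ι) (S : Finset ι) :
    signWeight q i S ≠ 0 := Finset.prod_ne_zero_iff.2 fun j _ => signParam_ne_zero hq i j

theorem signWeight_mul_signWeight (hq : IsSkewParam q) {i j : ι} (hij : i ≠ j) {S : Finset ι}
    (hi : i ∈ S) (hj : j ∈ S) : signWeight q i S * signWeight q j (S.erase i) =
      -q i j ^ 2 * (signWeight q j S * signWeight q i (S.erase j)) := by
  rw [signWeight_erase i hj, signWeight_erase j hi, ← signParam_sq]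
  linear_combination (signParam q i j * signWeight q i (S.erase j) * signWeight q j (S.erase i)) *
    signParam_mul_swap hq hij

/-- The twisted antisymmetric tensor with index `S`. -/
def altTensor (q : ι → ι → ℂ) : ℕ → Finset ι → FreeAlgebra ℂ ι
  | 0, _ => 1
  | k + 1, S => ∑ i ∈ S, signWeight q i S • (altTensor q k (S.erase i) * FreeAlgebra.ι ℂ i)

theorem dropLast_altTensor (k : ℕ) (S : Finset ι) (i : ι) :
    dropLast i (altTensor q (k + 1) S) =
      if i ∈ S then signWeight q i S • altTensor q k (S.erase i) else 0 := by
  rw [altTensor, map_sum]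
  simp only [map_smul, QuadraticData.dropLast_mul_gen, smul_ite, smul_zero, Finset.sum_ite_eq']

/-- The linear functionals dual to the twisted antisymmetric tensors. -/
def altCoord (q : ι → ι → ℂ) : ℕ → Finset ι → FreeAlgebra ℂ ι →ₗ[ℂ] ℂ
  | 0, _ => (FreeAlgebra.algebraMapInv : FreeAlgebra ℂ ι →ₐ[ℂ] ℂ).toLinearMap
  | k + 1, S => if h : S.Nonempty then
      (signWeight q (S.min' h) S)⁻¹ • altCoord q k (S.erase (S.min' h)) ∘ₗ dropLast (S.min' h)
    else 0

theorem altCoord_succ (k : ℕ) {S : Finset ι} (h : S.Nonempty) (x : FreeAlgebra ℂ ι) :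
    altCoord q (k + 1) S x = (signWeight q (S.min' h) S)⁻¹ *
      altCoord q k (S.erase (S.min' h)) (dropLast (S.min' h) x) := by
  rw [altCoord, dif_pos h]; rfl

theorem altCoord_altTensor (hq : IsSkewParam q) {k : ℕ} {S T : Finset ι} (hS : S.card = k)
    (hT : T.card = k) : altCoord q k S (altTensor q k T) = if S = T then 1 else 0 := by
  induction k generalizing S T with
  | zero =>
    rw [Finset.card_eq_zero] at hS hT
    rw [hS, hT, if_pos rfl, altCoord, altTensor, AlgHom.toLinearMap_apply, map_one]
  | succ k ih =>
    have h : S.Nonempty := Finset.card_pos.1 (by omega)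
    rw [altCoord_succ k h, dropLast_altTensor]
    set i := S.min' h
    have hi : i ∈ S := S.min'_mem h
    by_cases hiT : i ∈ T
    · rw [if_pos hiT, map_smul, ih (by rw [Finset.card_erase_of_mem hi]; omega)
        (by rw [Finset.card_erase_of_mem hiT]; omega)]
      by_cases hST : S = T
      · subst hST
        rw [if_pos rfl, if_pos rfl, smul_eq_mul, mul_one,
          inv_mul_cancel₀ (signWeight_ne_zero hq i S)]
      · rw [if_neg hST, if_neg, smul_zero, mul_zero]
        intro he
        exact hST (by rw [← Finset.insert_erase hi, he, Finset.insert_erase hiT])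
    · rw [if_neg hiT, map_zero, mul_zero, if_neg]
      rintro rfl
      exact hiT hi

variable [Fintype ι]

/-- Contractions of twisted antisymmetric tensors are multiples of smaller ones, so the recursive
criterion reduces to the commutation rule for two contractions, which is
`signWeight_mul_signWeight`. -/
theorem altTensor_mem (hq : IsSkewParam q) (k : ℕ) (S : Finset ι) :
    altTensor q k S ∈ (quantumSpace q).koszulSpace k := by
  induction k generalizing S with
  | zero =>
    refine ⟨by rw [pow_zero]; exact Submodule.one_le.1 le_rfl, ?_⟩
    exact Submodule.mem_iInf _ |>.2 fun p => Submodule.mem_iInf _ |>.2 fun hp => by omega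
  | succ k ih =>
    have hmem : altTensor q (k + 1) S ∈ freeGen ι ^ (k + 1) := by
      rw [altTensor, pow_succ]
      exact Submodule.sum_mem _ fun i _ => Submodule.smul_mem _ _
        (Submodule.mul_mem_mul (ih _).1 (ι_mem_freeGen i))
    refine (quantumSpace q).mem_koszulSpace_succ.2 ⟨hmem, fun i => ?_, ?_⟩
    · rw [dropLast_altTensor]
      split_ifs
      exacts [Submodule.smul_mem _ _ (ih _), zero_mem _]
    · rintro m rfl
      refine mem_pow_mul_R hmem fun i j => ?_
      rw [dropLast_altTensor, dropLast_altTensor]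
      by_cases hi : i ∈ S <;> by_cases hj : j ∈ S <;> by_cases hij : i = j
      · subst hij
        simp [hi, dropLast_altTensor]
      · simp only [hi, hj, if_true, map_smul, dropLast_altTensor, Finset.mem_erase, ne_eq,
          hij, Ne.symm hij, not_false_eq_true, and_self, smul_smul, Finset.erase_right_comm (a := j)]
        rw [signWeight_mul_signWeight hq hij hi hj]
      all_goals simp_all [dropLast_altTensor]

/-- Coordinates contract the smallest index first. An arbitrary contraction is brought to this order
by commuting it past the smaller indices; a repeated index gives zero. Hence the coordinates of `∂ᵢ
x` are determined by those of `x`. -/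
theorem altCoord_dropLast (hq : IsSkewParam q) {k : ℕ} {T : Finset ι} (hT : T.card = k)
    {x : FreeAlgebra ℂ ι} (hx : x ∈ (quantumSpace q).koszulSpace (k + 1)) (i : ι) :
    altCoord q k T (dropLast i x) =
      if i ∈ T then 0 else signWeight q i T * altCoord q (k + 1) (insert i T) x := by
  induction k generalizing T x i with
  | zero =>
    rw [Finset.card_eq_zero] at hT
    subst hT
    have h : (insert i (∅ : Finset ι)).Nonempty := Finset.insert_nonempty _ _
    have hm : (insert i (∅ : Finset ι)).min' h = i := by simp
    rw [altCoord_succ 0 h, hm]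
    simp [signWeight, signParam_self hq, altCoord]
  | succ k ih =>
    have h : T.Nonempty := Finset.card_pos.1 (by omega)
    have hw := fun j S => signWeight_ne_zero hq j S
    by_cases hmin : i ∉ T ∧ i < T.min' h
    · have h' : (insert i T).Nonempty := Finset.insert_nonempty _ _
      have hm : (insert i T).min' h' = i := by
        rw [Finset.min'_insert _ _ h, min_eq_left hmin.2.le]
      rw [if_neg hmin.1, altCoord_succ _ h', hm, Finset.erase_insert hmin.1,
        signWeight_insert i hmin.1, signParam_self hq, one_mul, mul_inv_cancel_left₀ (hw _ _)]
    · rw [altCoord_succ k h]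
      set j := T.min' h
      have hj : j ∈ T := T.min'_mem h
      have hsw := dropLast_dropLast_of_mem_koszulSpace hq hx i j
      by_cases hij : i = j
      · rw [← hij, hq.diag, one_pow, neg_one_smul, self_eq_neg] at hsw
        rw [if_pos (hij ▸ hj), ← hij, hsw, map_zero, mul_zero]
      rw [hsw, map_smul, ih (by rw [Finset.card_erase_of_mem hj]; omega)
        ((quantumSpace q).dropLast_mem_koszulSpace j _ hx)]
      by_cases hi : i ∈ T
      · rw [if_pos hi, if_pos (Finset.mem_erase.2 ⟨hij, hi⟩), smul_zero, mul_zero]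
      · have hlt : j < i := lt_of_le_of_ne (not_lt.1 fun h => hmin ⟨hi, h⟩) (Ne.symm hij)
        have h' : (insert i T).Nonempty := Finset.insert_nonempty _ _
        have hm : (insert i T).min' h' = j := by
          rw [Finset.min'_insert _ _ h, min_eq_right hlt.le]
        rw [if_neg hi, if_neg (fun h => hi (Finset.mem_of_mem_erase h)),
          altCoord_succ (k + 1) h', hm, Finset.erase_insert_of_ne hij, signWeight_insert j hi,
          signWeight_erase i hj, ← signParam_sq, smul_eq_mul]
        have h₁ := signParam_mul_swap hq hij
        have h₂ := signParam_ne_zero hq j i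
        have h₃ := hw j T
        have h₄ : signParam q i j = -(signParam q j i)⁻¹ := by
          field_simp
          linear_combination h₁
        rw [h₄]
        field_simp

theorem eq_zero_of_altCoord_eq_zero (hq : IsSkewParam q) {k : ℕ} {x : FreeAlgebra ℂ ι}
    (hx : x ∈ (quantumSpace q).koszulSpace k)
    (h : ∀ S : Finset ι, S.card = k → altCoord q k S x = 0) : x = 0 := by
  induction k generalizing x with
  | zero =>
    obtain ⟨c, rfl⟩ := Submodule.mem_one.1 (pow_zero (freeGen ι) ▸ hx.1)
    have := h ∅ rfl
    rw [altCoord, AlgHom.toLinearMap_apply, AlgHom.commutes] at this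
    rw [show c = 0 from this, map_zero]
  | succ k ih =>
    rw [← sum_dropLast_mul_of_mem_pow hx.1]
    refine Finset.sum_eq_zero fun i _ => ?_
    rw [ih ((quantumSpace q).dropLast_mem_koszulSpace i k hx) fun T hT => ?_, zero_mul]
    rw [altCoord_dropLast hq hT hx]
    split_ifs with hi
    · rfl
    · rw [h _ (by rw [Finset.card_insert_of_notMem hi, hT]), mul_zero]

theorem altCoord_sum (hq : IsSkewParam q) {k : ℕ} (f : {S : Finset ι // S.card = k} → ℂ)
    (S : {S : Finset ι // S.card = k}) :
    altCoord q k S (∑ T, f T • altTensor q k (T : Finset ι)) = f S := by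
  rw [map_sum, Finset.sum_eq_single S]
  · rw [map_smul, altCoord_altTensor hq S.prop S.prop, if_pos rfl, smul_eq_mul, mul_one]
  · intro T _ hT
    rw [map_smul, altCoord_altTensor hq S.prop T.prop, if_neg fun h => hT (Subtype.ext h.symm),
      smul_zero]
  · exact fun h => absurd (Finset.mem_univ _) h

/-- The basis of twisted antisymmetric tensors of the Koszul space. -/
def altBasis (hq : IsSkewParam q) (k : ℕ) :
    Module.Basis {S : Finset ι // S.card = k} ℂ ((quantumSpace q).koszulSpace k) :=
  .ofEquivFun
    { toFun := fun x S => altCoord q k S x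
      map_add' := fun x y => funext fun S => map_add _ _ _
      map_smul' := fun c x => funext fun S => map_smul _ _ _
      invFun := fun f => ∑ S, f S • ⟨altTensor q k S, altTensor_mem hq k S⟩
      left_inv := fun x => by
        rw [← sub_eq_zero]
        refine Subtype.ext (eq_zero_of_altCoord_eq_zero hq (Subtype.prop _) fun S hS => ?_)
        have := altCoord_sum hq (fun S => altCoord q k S x) ⟨S, hS⟩
        rw [Submodule.coe_sub, map_sub, sub_eq_zero, AddSubmonoidClass.coe_finsetSum]
        exact this
      right_inv := fun f => funext fun S => by
        refine (congrArg (altCoord q k S) (AddSubmonoidClass.coe_finsetSum ..)).trans ?_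
        exact altCoord_sum hq f S }

theorem altBasis_apply (hq : IsSkewParam q) (k : ℕ) (S : {S : Finset ι // S.card = k}) :
    altBasis hq k S = ⟨altTensor q k S, altTensor_mem hq k S⟩ := by
  rw [altBasis, Module.Basis.coe_ofEquivFun]
  change ∑ T, (Pi.single S 1 : _ → ℂ) T • _ = _
  rw [Finset.sum_eq_single S]
  · rw [Pi.single_eq_same, one_smul]
  · intro T _ hT
    rw [Pi.single_eq_of_ne hT, zero_smul]
  · exact fun h => absurd (Finset.mem_univ _) h

theorem koszulSpace_ne_bot_iff (hq : IsSkewParam q) (k : ℕ) :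
    (quantumSpace q).koszulSpace k ≠ ⊥ ↔ k ≤ Fintype.card ι := by
  rw [← Submodule.nontrivial_iff_ne_bot]
  constructor
  · intro h
    obtain ⟨S⟩ := (altBasis hq k).index_nonempty
    rw [← S.prop]
    exact S.1.card_le_univ
  · intro h
    obtain ⟨S, hS⟩ := Finset.exists_subset_card_eq (s := (Finset.univ : Finset ι)) h
    exact ⟨⟨_, 0, (altBasis hq k).ne_zero ⟨S, hS.2⟩⟩⟩

end Sign

end quantumSpace

/-! ### The Koszul complex of a quantum affine space -/

namespace quantumSpace

/-! ### The complex in multigraded coordinates and its homotopy. -/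

section Total

variable {ι : Type} [LinearOrder ι] {q : ι → ι → ℂ}

/-- The matrix coefficients of the Koszul differential. -/
def koszulCoeff (q : ι → ι → ℂ) (i : ι) (a : Multiset ι) (S : Finset ι) : ℂ :=
  weight q i a * signWeight q i S

theorem koszulCoeff_ne_zero (hq : IsSkewParam q) (i : ι) (a : Multiset ι) (S : Finset ι) :
    koszulCoeff q i a S ≠ 0 := mul_ne_zero (weight_ne_zero hq i a) (signWeight_ne_zero hq i S)

/-- The two ways of moving `i` and `j` from `insert j S` to the monomial anticommute: this is the
cancellation behind the homotopy. -/
theorem koszulCoeff_mul (hq : IsSkewParam q) {i j : ι} (hij : i ≠ j) (a : Multiset ι)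
    {S : Finset ι} (hi : i ∈ S) (hj : j ∉ S) :
    koszulCoeff q i (j ::ₘ a) S * koszulCoeff q j a (insert j S) =
      -(koszulCoeff q i a (insert j S) * koszulCoeff q j (i ::ₘ a) (insert j (S.erase i))) := by
  have hj' : j ∉ S.erase i := fun h => hj (Finset.mem_of_mem_erase h)
  simp only [koszulCoeff, weight_cons, signWeight_insert _ hj, signWeight_insert _ hj',
    signWeight_erase j hi, signParam_self hq]
  have h₁ := signParam_mul_swap hq hij
  have h₂ := hq.mul_swap i j
  have h₃ : q i j * signParam q j i = -(signParam q i j * q j i) := by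
    have h₄ := signParam_sq (q := q) i j
    linear_combination (-q i j * signParam q j i) * h₂ - (signParam q j i * q j i) * h₄ +
      signParam q i j * q j i * h₁
  linear_combination (weight q i a * signWeight q i S * weight q j a *
    signWeight q j (S.erase i)) * h₃

/-- The space with basis the `w^a ⊗ e_S`. -/
abbrev Total (ι : Type) : Type := Multiset ι × Finset ι →₀ ℂ

/-- The Koszul differential in coordinates. -/
def totalD (q : ι → ι → ℂ) : Total ι →ₗ[ℂ] Total ι :=
  Finsupp.lift _ ℂ _ fun p =>
    ∑ i ∈ p.2, koszulCoeff q i p.1 p.2 • Finsupp.single (i ::ₘ p.1, p.2.erase i) 1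

theorem totalD_single (p : Multiset ι × Finset ι) : totalD q (Finsupp.single p 1) =
    ∑ i ∈ p.2, koszulCoeff q i p.1 p.2 • Finsupp.single (i ::ₘ p.1, p.2.erase i) 1 := by
  simp [totalD]

/-- The part of the homotopy given by a direction `j`. -/
def homotopyAt (q : ι → ι → ℂ) (j : ι) (p : Multiset ι × Finset ι) : Total ι :=
  if j ∈ p.2 then 0
  else (koszulCoeff q j (p.1.erase j) (insert j p.2))⁻¹ •
    Finsupp.single (p.1.erase j, insert j p.2) 1

open Classical in
/-- A contracting homotopy of the Koszul complex in coordinates; it depends on the choice of an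
index in the multidegree. -/
def totalH (q : ι → ι → ℂ) : Total ι →ₗ[ℂ] Total ι :=
  Finsupp.lift _ ℂ _ fun p =>
    if h : ∃ j, j ∈ p.1 + p.2.val then homotopyAt q h.choose p else 0

open Classical in
theorem totalH_single (p : Multiset ι × Finset ι) : totalH q (Finsupp.single p 1) =
    if h : ∃ j, j ∈ p.1 + p.2.val then homotopyAt q h.choose p else 0 := by
  simp [totalH]

/-- Let `j` be the chosen index. If `j ∈ S`, the homotopy kills the vector, and only the term of the
differential removing `j` survives and is moved back. If `j ∉ S`, moving `j` into `S` and out again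
gives the identity, and the other terms cancel by `koszulCoeff_mul`. -/
theorem homotopy_single (hq : IsSkewParam q) {p : Multiset ι × Finset ι} (hp : p ≠ (0, ∅)) :
    totalD q (totalH q (Finsupp.single p 1)) + totalH q (totalD q (Finsupp.single p 1)) =
      Finsupp.single p 1 := by
  obtain ⟨a, S⟩ := p
  have hex : ∃ j, j ∈ a + S.val := Multiset.exists_mem_of_ne_zero fun h => hp (by
    rw [add_eq_zero] at h
    rw [h.1, Finset.val_eq_zero.1 h.2])
  have hdeg : ∀ i ∈ S, i ::ₘ a + (S.erase i).val = a + S.val := fun i hi => by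
    rw [Finset.erase_val, Multiset.cons_add, ← Multiset.add_cons, Multiset.cons_erase hi]
  -- The choice depends only on the multidegree, which the differential preserves, so one `j` serves
  -- for all terms.
  obtain ⟨j, hj, hH⟩ : ∃ j ∈ a + S.val, ∀ b T, b + T.val = a + S.val →
      totalH q (Finsupp.single (b, T) 1) = homotopyAt q j (b, T) := by
    refine ⟨hex.choose, hex.choose_spec, fun b T h => ?_⟩
    have : ∃ j, j ∈ b + T.val := h ▸ hex
    rw [totalH_single, dif_pos this]
    congr 2
    simp only [h]
  rw [hH a S rfl, totalD_single, map_sum]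
  simp only [map_smul]
  rw [Finset.sum_congr rfl fun i hi => by rw [hH _ _ (hdeg i hi)]]
  by_cases hjS : j ∈ S
  · rw [homotopyAt, if_pos hjS, map_zero, zero_add, Finset.sum_eq_single_of_mem j hjS]
    · rw [homotopyAt, if_neg (Finset.notMem_erase j S)]
      simp only [Multiset.erase_cons_head, Finset.insert_erase hjS]
      rw [smul_smul, mul_inv_cancel₀ (koszulCoeff_ne_zero hq _ _ _), one_smul]
    · intro i hi hij
      rw [homotopyAt, if_pos (Finset.mem_erase.2 ⟨hij.symm, hjS⟩), smul_zero]
  · have hja : j ∈ a := (Multiset.mem_add.1 hj).resolve_right hjS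
    obtain ⟨a, rfl⟩ := Multiset.exists_cons_of_mem hja
    rw [homotopyAt, if_neg hjS]
    simp only [Multiset.erase_cons_head]
    rw [map_smul, totalD_single, Finset.sum_insert hjS, smul_add, smul_smul,
      inv_mul_cancel₀ (koszulCoeff_ne_zero hq _ _ _), one_smul, Finset.erase_insert hjS, add_assoc,
      Finset.smul_sum, ← Finset.sum_add_distrib, Finset.sum_eq_zero, add_zero]
    intro i hi
    have hij : i ≠ j := fun h => hjS (h ▸ hi)
    rw [homotopyAt, if_neg fun h => hjS (Finset.mem_of_mem_erase h)]
    simp only [Multiset.cons_swap i j, Multiset.erase_cons_head,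
      Finset.erase_insert_of_ne hij.symm, smul_smul, ← add_smul]
    have h := koszulCoeff_mul hq hij a hi hjS
    have h₁ := koszulCoeff_ne_zero hq j a (insert j S)
    have h₂ := koszulCoeff_ne_zero hq j (i ::ₘ a) (insert j (S.erase i))
    convert zero_smul ℂ _ using 2
    field_simp
    linear_combination h

theorem homotopy (hq : IsSkewParam q) (x : Total ι) :
    totalD q (totalH q x) + totalH q (totalD q x) = x - Finsupp.single (0, ∅) (x (0, ∅)) := by
  refine LinearMap.congr_fun (Finsupp.lhom_ext' fun p => LinearMap.ext_ring ?_ :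
    totalD q ∘ₗ totalH q + totalH q ∘ₗ totalD q =
      LinearMap.id - Finsupp.lsingle (0, ∅) ∘ₗ Finsupp.lapply (0, ∅)) x
  by_cases hp : p = (0, ∅)
  · subst hp
    simp [totalD_single, totalH_single]
  · have := homotopy_single hq hp
    simpa [Finsupp.single_eq_of_ne' hp] using this

/-- The homotopy raises the homological degree by one. -/
theorem totalH_mem_supported {k : ℕ} {x : Total ι}
    (hx : x ∈ Finsupp.supported ℂ ℂ {p : Multiset ι × Finset ι | p.2.card = k}) :
    totalH q x ∈ Finsupp.supported ℂ ℂ {p : Multiset ι × Finset ι | p.2.card = k + 1} := by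
  rw [Finsupp.supported_eq_span_single] at hx
  induction hx using Submodule.span_induction with
  | mem x h =>
    obtain ⟨p, hp, rfl⟩ := h
    rw [totalH_single]
    split_ifs
    · rw [homotopyAt]
      split_ifs with hj
      · exact zero_mem _
      · refine Submodule.smul_mem _ _ (Finsupp.single_mem_supported ℂ _ ?_)
        rw [Set.mem_ofPred_eq, Finset.card_insert_of_notMem hj, hp]
    · exact zero_mem _
  | zero => rw [map_zero]; exact zero_mem _
  | add x y _ _ hx hy => rw [map_add]; exact add_mem hx hy
  | smul c x _ hx => rw [map_smul]; exact Submodule.smul_mem _ _ hx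

end Total

theorem koszulAug_tmul {ι : Type} {q : ι → ι → ℂ} (a : QAlg q)
    (w : (quantumSpace q).koszulSpace 0) : (quantumSpace q).koszulAug (a ⊗ₜ w) =
      (show ℂ from (quantumSpace q).augmentation a *
        FreeAlgebra.algebraMapInv (w : FreeAlgebra ℂ ι)) := by
  change (quantumSpace q).augmentation
    ((FreeAlgebra.algebraMapInv (w : FreeAlgebra ℂ ι) : ℂ) • a) = _
  rw [map_smul, smul_eq_mul, mul_comm]

/-! ### Exactness of the Koszul complex via coordinates. -/

section Koszul

variable {ι : Type} [LinearOrder ι] [Fintype ι] {q : ι → ι → ℂ} (hq : IsSkewParam q)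

/-- The basis `w^a ⊗ e_S` of the `k`-th term of the Koszul complex. -/
def koszulBasis (k : ℕ) :
    Module.Basis (Multiset ι × {S : Finset ι // S.card = k}) ℂ ((quantumSpace q).koszul k) :=
  (monBasis hq).tensorProduct (altBasis hq k)

theorem koszulBasis_apply {k : ℕ} (a : Multiset ι) (S : {S : Finset ι // S.card = k}) :
    koszulBasis hq k (a, S) = mon hq a ⊗ₜ[ℂ] ⟨altTensor q k S, altTensor_mem hq k S⟩ := by
  rw [koszulBasis, Module.Basis.tensorProduct_apply, monBasis_apply, altBasis_apply]

/-- The coordinates of the elements of the Koszul complex. -/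
def koszulCoord (k : ℕ) : (quantumSpace q).koszul k →ₗ[ℂ] Total ι :=
  Finsupp.lmapDomain ℂ ℂ (Prod.map id Subtype.val) ∘ₗ (koszulBasis hq k).repr.toLinearMap

theorem koszulCoord_basis {k : ℕ} (p : Multiset ι × {S : Finset ι // S.card = k}) :
    koszulCoord hq k (koszulBasis hq k p) = Finsupp.single (p.1, p.2.val) 1 := by
  simp [koszulCoord, Prod.map]

theorem koszulCoord_injective (k : ℕ) : Function.Injective (koszulCoord hq k) :=
  (Finsupp.mapDomain_injective (Function.injective_id.prodMap Subtype.val_injective)).comp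
    (koszulBasis hq k).repr.injective

theorem range_koszulCoord (k : ℕ) : (koszulCoord hq k).range =
    Finsupp.supported ℂ ℂ {p : Multiset ι × Finset ι | p.2.card = k} := by
  rw [← Submodule.map_top, ← (koszulBasis hq k).span_eq, Submodule.map_span,
    Finsupp.supported_eq_span_single]
  congr 1
  ext x
  constructor
  · rintro ⟨_, ⟨p, rfl⟩, rfl⟩
    exact ⟨(p.1, p.2.val), p.2.prop, (koszulCoord_basis hq p).symm⟩
  · rintro ⟨p, hp, rfl⟩
    exact ⟨_, ⟨(p.1, ⟨p.2, hp⟩), rfl⟩, koszulCoord_basis hq _⟩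

/-- The Koszul differential as a complex linear map. -/
def koszulLin (q : ι → ι → ℂ) (k : ℕ) :
    (quantumSpace q).koszul (k + 1) →ₗ[ℂ] (quantumSpace q).koszul k :=
  ∑ i : ι, TensorProduct.map (LinearMap.mulLeft ℂ (X q i))
    ((dropLast i).restrict fun _ hx => (quantumSpace q).dropLast_mem_koszulSpace i k hx)

theorem koszulD_tmul (k : ℕ) (a : QAlg q) (w : (quantumSpace q).koszulSpace (k + 1)) :
    (quantumSpace q).koszulD k (a ⊗ₜ w) = ∑ i : ι, (X q i * a) ⊗ₜ[ℂ]
      (⟨dropLast i w, (quantumSpace q).dropLast_mem_koszulSpace i k w.prop⟩ :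
        (quantumSpace q).koszulSpace k) := by
  rw [QuadraticData.koszulD, LinearMap.sum_apply]
  rfl

theorem koszulLin_tmul (k : ℕ) (a : QAlg q) (w : (quantumSpace q).koszulSpace (k + 1)) :
    koszulLin q k (a ⊗ₜ w) = ∑ i : ι, (X q i * a) ⊗ₜ[ℂ]
      (⟨dropLast i w, (quantumSpace q).dropLast_mem_koszulSpace i k w.prop⟩ :
        (quantumSpace q).koszulSpace k) := by
  rw [koszulLin, LinearMap.sum_apply]
  rfl

theorem koszulD_eq (k : ℕ) (x : (quantumSpace q).koszul (k + 1)) :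
    (quantumSpace q).koszulD k x = koszulLin q k x := by
  induction x using TensorProduct.induction_on with
  | zero => rw [map_zero, map_zero]
  | tmul a w => rw [koszulD_tmul, koszulLin_tmul]
  | add x y hx hy => rw [map_add, map_add, hx, hy]

theorem koszulCoord_koszulD (k : ℕ) (x : (quantumSpace q).koszul (k + 1)) :
    koszulCoord hq k ((quantumSpace q).koszulD k x) = totalD q (koszulCoord hq (k + 1) x) := by
  rw [koszulD_eq]
  refine LinearMap.congr_fun ((koszulBasis hq (k + 1)).ext fun p => ?_ :
    koszulCoord hq k ∘ₗ koszulLin q k = totalD q ∘ₗ koszulCoord hq (k + 1)) x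
  obtain ⟨a, S, hS⟩ := p
  rw [LinearMap.comp_apply, LinearMap.comp_apply, koszulCoord_basis, totalD_single,
    koszulBasis_apply, koszulLin_tmul, map_sum]
  rw [← Finset.sum_subset (Finset.subset_univ S)]
  · refine Finset.sum_congr rfl fun i hi => ?_
    have hc : (S.erase i).card = k := by rw [Finset.card_erase_of_mem hi, hS]; rfl
    have h : (⟨dropLast i (altTensor q (k + 1) S), (quantumSpace q).dropLast_mem_koszulSpace i k
        (altTensor_mem hq (k + 1) S)⟩ : (quantumSpace q).koszulSpace k) =
        signWeight q i S • ⟨altTensor q k (S.erase i), altTensor_mem hq k _⟩ :=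
      Subtype.ext ((dropLast_altTensor k S i).trans (if_pos hi))
    have hb := koszulBasis_apply hq (k := k) (i ::ₘ a) ⟨S.erase i, hc⟩
    rw [h, X_mul_mon, TensorProduct.tmul_smul, ← TensorProduct.smul_tmul', smul_smul, ← hb,
      map_smul, koszulCoord_basis, mul_comm]
    rfl
  · intro i _ hi
    have h : (⟨dropLast i (altTensor q (k + 1) S), (quantumSpace q).dropLast_mem_koszulSpace i k
        (altTensor_mem hq (k + 1) S)⟩ : (quantumSpace q).koszulSpace k) = 0 :=
      Subtype.ext ((dropLast_altTensor k S i).trans (if_neg hi))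
    rw [h, TensorProduct.tmul_zero, map_zero]

/-- The augmentation is the coordinate in multidegree zero, the only one the homotopy does not
contract. -/
theorem koszulAug_eq (x : (quantumSpace q).koszul 0) :
    (quantumSpace q).koszulAug x = (show ℂ from koszulCoord hq 0 x (0, ∅)) := by
  let f : (quantumSpace q).koszul 0 →ₗ[ℂ] ℂ := LinearMap.mul' ℂ ℂ ∘ₗ
    TensorProduct.map (quantumSpace q).augmentation.toLinearMap
      ((FreeAlgebra.algebraMapInv : FreeAlgebra ℂ ι →ₐ[ℂ] ℂ).toLinearMap ∘ₗ
        ((quantumSpace q).koszulSpace 0).subtype)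
  have h₁ : (quantumSpace q).koszulAug x = (show TrivialModule _ from f x) := by
    induction x using TensorProduct.induction_on with
    | zero => rw [map_zero, map_zero]; rfl
    | tmul a w => exact koszulAug_tmul a w
    | add x y hx hy => rw [map_add, map_add, hx, hy]; rfl
  refine h₁.trans (LinearMap.congr_fun ((koszulBasis hq 0).ext fun p => ?_ :
    f = Finsupp.lapply (0, ∅) ∘ₗ koszulCoord hq 0) x)
  obtain ⟨a, S, hS⟩ := p
  obtain rfl := Finset.card_eq_zero.1 hS
  rw [LinearMap.comp_apply (Finsupp.lapply (0, ∅)), koszulCoord_basis, koszulBasis_apply]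
  change (quantumSpace q).augmentation (mon hq a) *
    FreeAlgebra.algebraMapInv (1 : FreeAlgebra ℂ ι) = Finsupp.single (a, ∅) 1 (0, ∅)
  rw [map_one, mul_one, ← repr_zero (hq := hq), repr_mon]
  by_cases h : a = 0 <;> simp [h]

theorem koszulD_koszulD (hq : IsSkewParam q) (k : ℕ) (x : (quantumSpace q).koszul (k + 2)) :
    (quantumSpace q).koszulD k ((quantumSpace q).koszulD (k + 1) x) = 0 := by
  induction x using TensorProduct.induction_on with
  | zero => rw [map_zero, map_zero]
  | add x y hx hy => rw [map_add, map_add, hx, hy, add_zero]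
  | tmul a w =>
    rw [koszulD_tmul, map_sum]
    simp only [koszulD_tmul]
    let t (i j : ι) : (quantumSpace q).koszul k := (X q j * (X q i * a)) ⊗ₜ[ℂ]
      (⟨dropLast j (dropLast i w), (quantumSpace q).dropLast_mem_koszulSpace j k
        ((quantumSpace q).dropLast_mem_koszulSpace i (k + 1) w.prop)⟩ :
        (quantumSpace q).koszulSpace k)
    -- The factor `q i j ^ 2` from commuting generators cancels the one from commuting contractions,
    -- leaving the sign; so the double sum equals its own negative.
    have ht : ∀ i j, t i j = -t j i := fun i j => by
      have h : (⟨dropLast j (dropLast i w), (quantumSpace q).dropLast_mem_koszulSpace j k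
          ((quantumSpace q).dropLast_mem_koszulSpace i (k + 1) w.prop)⟩ :
          (quantumSpace q).koszulSpace k) = -(q i j ^ 2 •
          ⟨dropLast i (dropLast j w), (quantumSpace q).dropLast_mem_koszulSpace i k
            ((quantumSpace q).dropLast_mem_koszulSpace j (k + 1) w.prop)⟩) :=
        Subtype.ext ((dropLast_dropLast_of_mem_koszulSpace hq w.prop i j).trans (neg_smul ..))
      have hm : X q i * (X q j * a) = q i j ^ 2 • (X q j * (X q i * a)) := by
        rw [← mul_assoc, X_mul_X, smul_mul_assoc, mul_assoc]
      change (X q j * (X q i * a)) ⊗ₜ[ℂ] _ = -((X q i * (X q j * a)) ⊗ₜ[ℂ] _)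
      rw [h, hm, TensorProduct.tmul_neg, TensorProduct.tmul_smul,
        TensorProduct.smul_tmul']
    change ∑ i, ∑ j, t i j = 0
    have hs : ∑ i, ∑ j, t i j = -∑ i, ∑ j, t i j := by
      conv_lhs => rw [Finset.sum_comm]
      rw [← Finset.sum_neg_distrib]
      refine Finset.sum_congr rfl fun i _ => ?_
      rw [← Finset.sum_neg_distrib]
      exact Finset.sum_congr rfl fun j _ => ht j i
    have h2 : (2 : ℂ) • ∑ i, ∑ j, t i j = 0 := by
      rw [two_smul]
      nth_rewrite 1 [hs]
      exact neg_add_cancel _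
    exact (smul_eq_zero.1 h2).resolve_left two_ne_zero

theorem koszulAug_koszulD (x : (quantumSpace q).koszul 1) :
    (quantumSpace q).koszulAug ((quantumSpace q).koszulD 0 x) = 0 := by
  induction x using TensorProduct.induction_on with
  | zero => rw [map_zero, map_zero]
  | add x y hx hy => rw [map_add, map_add, hx, hy, add_zero]
  | tmul a w =>
    rw [koszulD_tmul, map_sum]
    refine Finset.sum_eq_zero fun i _ => (koszulAug_tmul _ _).trans ?_
    rw [map_mul, QuadraticData.augmentation_gen, zero_mul, zero_mul]
    rfl

include hq in
/-- A cycle whose coordinates are fixed by the homotopy is a boundary. -/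
theorem exists_koszulD_eq {k : ℕ} {x : (quantumSpace q).koszul k}
    (h₁ : totalD q (koszulCoord hq k x) = 0) (h₂ : koszulCoord hq k x (0, ∅) = 0) :
    ∃ y, (quantumSpace q).koszulD k y = x := by
  have h := homotopy hq (koszulCoord hq k x)
  rw [h₁, map_zero, add_zero, h₂, Finsupp.single_zero, sub_zero] at h
  have hx : koszulCoord hq k x ∈ (koszulCoord hq k).range := ⟨x, rfl⟩
  rw [range_koszulCoord] at hx
  have hy := totalH_mem_supported (q := q) hx
  rw [← range_koszulCoord hq] at hy
  obtain ⟨y, hy⟩ := hy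
  exact ⟨y, koszulCoord_injective hq k (by rw [koszulCoord_koszulD, hy, h])⟩

theorem koszulCoord_eq_zero_of_ne {k : ℕ} (x : (quantumSpace q).koszul k)
    {p : Multiset ι × Finset ι} (hp : p.2.card ≠ k) : koszulCoord hq k x p = 0 := by
  have hx : koszulCoord hq k x ∈ (koszulCoord hq k).range := ⟨x, rfl⟩
  rw [range_koszulCoord, Finsupp.mem_supported'] at hx
  exact hx p hp

theorem totalD_koszulCoord_zero (x : (quantumSpace q).koszul 0) :
    totalD q (koszulCoord hq 0 x) = 0 := by
  refine LinearMap.congr_fun ((koszulBasis hq 0).ext fun p => ?_ :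
    totalD q ∘ₗ koszulCoord hq 0 = 0) x
  obtain ⟨a, S, hS⟩ := p
  obtain rfl := Finset.card_eq_zero.1 hS
  rw [LinearMap.comp_apply, koszulCoord_basis, totalD_single]
  rfl

/-- The basis `e_S` of the right module `W_k ⊗ A`. -/
def koszulRightBasis (k : ℕ) : Module.Basis (Unit × {S : Finset ι // S.card = k}) (QAlg q)ᵐᵒᵖ
    ((quantumSpace q).koszul k) :=
  ((Module.Basis.singleton Unit (QAlg q)ᵐᵒᵖ).map (rightRegularEquiv (QAlg q))).tensorProduct
    (altBasis hq k)

theorem koszulD_mem (k : ℕ) (x : (quantumSpace q).koszul (k + 1)) :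
    (quantumSpace q).koszulD k x ∈ Submodule.span (QAlg q)ᵐᵒᵖ
      {y : (quantumSpace q).koszul k | ∃ (a : QAlg q) (z : (quantumSpace q).koszul k),
        (quantumSpace q).augmentation a = 0 ∧ y = op a • z} := by
  induction x using TensorProduct.induction_on with
  | zero => rw [map_zero]; exact zero_mem _
  | add x y hx hy => rw [map_add]; exact add_mem hx hy
  | tmul a w =>
    rw [koszulD_tmul]
    refine Submodule.sum_mem _ fun i _ => Submodule.subset_span ⟨X q i * a, 1 ⊗ₜ ⟨dropLast i w,
      (quantumSpace q).dropLast_mem_koszulSpace i k w.prop⟩, ?_, ?_⟩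
    · rw [map_mul, QuadraticData.augmentation_gen, zero_mul]
    · rw [TensorProduct.smul_tmul', op_smul_eq_mul, one_mul]

theorem isMinimalFreeResolution (hq : IsSkewParam q) :
    IsMinimalFreeResolution (quantumSpace q).augmentation (quantumSpace q).koszul
      (quantumSpace q).koszulD (quantumSpace q).koszulAug where
  free k := .of_basis (koszulRightBasis hq k)
  finite k := .of_basis (koszulRightBasis hq k)
  surjective c := ⟨algebraMap ℂ (QAlg q) c ⊗ₜ ⟨altTensor q 0 ∅, altTensor_mem hq 0 ∅⟩, by
    have h (z : ℂ) : (quantumSpace q).augmentation (algebraMap ℂ (QAlg q) z) *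
        FreeAlgebra.algebraMapInv (1 : FreeAlgebra ℂ ι) = z := by
      rw [AlgHom.commutes, map_one, mul_one, Algebra.algebraMap_self, RingHom.id_apply]
    exact (koszulAug_tmul _ _).trans (h c)⟩
  exact_zero x := by
    refine ⟨fun hx => exists_koszulD_eq hq (totalD_koszulCoord_zero hq x) ?_, ?_⟩
    · exact (koszulAug_eq hq x).symm.trans hx
    · rintro ⟨y, rfl⟩
      exact koszulAug_koszulD y
  exact_succ k x := by
    refine ⟨fun hx => exists_koszulD_eq hq ?_ (koszulCoord_eq_zero_of_ne hq x ?_), ?_⟩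
    · rw [← koszulCoord_koszulD, hx, map_zero]
    · rw [Finset.card_empty]
      exact (Nat.succ_ne_zero k).symm
    · rintro ⟨y, rfl⟩
      exact koszulD_koszulD hq k y
  minimal := koszulD_mem

end Koszul

end quantumSpace

/-! ### The noncommutative projective space -/

theorem isSkewParam_qParam {n : ℕ} {θ : Matrix (Fin n) (Fin n) ℂ} (hθ : θ.transpose = -θ) :
    IsSkewParam (qParam θ) := by
  have h : ∀ i j, thetaTilde θ j i = -thetaTilde θ i j := fun i j => by
    unfold thetaTilde
    by_cases hij : (i : ℕ) < n ∧ (j : ℕ) < n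
    · rw [dif_pos hij, dif_pos hij.symm, ← Matrix.transpose_apply θ, hθ, Matrix.neg_apply]
    · rw [dif_neg hij, dif_neg fun h => hij h.symm, neg_zero]
  refine ⟨fun i j => ?_, fun i => ?_⟩
  · rw [qParam, qParam, ← Complex.exp_add, h i j, mul_neg, add_neg_cancel, Complex.exp_zero]
  · rw [qParam, self_eq_neg.1 (h i i), mul_zero, Complex.exp_zero]

theorem mainTheorem4 (n : ℕ) (θ : Matrix (Fin n) (Fin n) ℂ) (hθ : θ.transpose = -θ) :
    IsRegularAlgebra (projectiveSpace θ).augmentation (n + 1) ∧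
    IsMinimalFreeResolution (projectiveSpace θ).augmentation (projectiveSpace θ).koszul
      (projectiveSpace θ).koszulD (projectiveSpace θ).koszulAug ∧
    ∀ k : ℕ, (projectiveSpace θ).koszulSpace k ≠ ⊥ ↔ k ≤ n + 1 := by
  have hq := isSkewParam_qParam hθ
  have h₁ := quantumSpace.isRegularAlgebra hq
  have h₃ := quantumSpace.koszulSpace_ne_bot_iff hq
  rw [Fintype.card_fin] at h₁ h₃
  -- `projectiveSpace θ` is definitionally `quantumSpace (qParam θ)`.
  exact ⟨h₁, quantumSpace.isMinimalFreeResolution hq, h₃⟩
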